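/- **Model.** Let $d=C-1\ge 1$, let $(n_j)_{j\ge 1}$ be any sequence of non-negative integers (batch sizes), and consider the model in which, given $(\mu,\Sigma)$, the observations $L_1,L_2,\dots\in\mathbb{R}^{d}$ are independent with $$L_j\sim \mathcal{N}_{d}\Big(\mu,\tfrac{\Sigma}{n_j+0.5}\Big),$$ with the hierarchical prior $$\mu\mid\Sigma_p\sim \mathcal{N}_{d}(\alpha,\Sigma_p),\qquad \Sigma\sim\text{Inverse Wishart}(\Psi,\nu),\qquad \Sigma_p\sim\text{Inverse Wishart}(\Psi_p,\nu_p),$$ where $(\mu,\Sigma_p)$ and $\Sigma$ are independent, $\alpha\in\mathbb{R}^d$, $\Psi,\Psi_p$ are symmetric positive definite $d\times d$ matrices, and $\nu,\nu_p>d-1$ are real. Here Inverse Wishart$(\Psi,\nu)$ is the distribution on the positive definite matrices with density $$\frac{|\Psi|^{\nu/2}}{2^{\nu d/2}\,\Gamma_d(\nu/2)}\,|S|^{-(\nu+d+1)/2}\exp\!\big(-\tfrac12\operatorname{tr}(\Psi S^{-1})\big)$$ with respect to Lebesgue measure in the coordinates $S_{ij}$, $i\le j$. For data $L_1,\dots,L_K$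 let $\Pi_K(\cdot\mid L_1,\dots,L_K)$ be the posterior distribution of $(\mu,\Sigma,\Sigma_p)$ given by Bayes' formula (density with respect to the prior proportional to the Gaussian likelihood), and let $\mu_{PM}=\mu_{PM}(L_1,\dots,L_K)$ and $\Sigma_{PM}=\Sigma_{PM}(L_1,\dots,L_K)$ be the posterior means of $\mu$ and $\Sigma$. **Theorem.** Let $\mu_0\in\mathbb{R}^d$ and let $\Sigma_0$ be a covariance matrix (symmetric positive semidefinite), and suppose that the data are generated under these true values: $L_1,L_2,\dots$ are independent with $L_j\sim\mathcal{N}_{d}(\mu_0,\Sigma_0/(n_j+0.5))$; let $\mathbb{E}$ be the expectation under this law. Then for all sufficiently large $K$ and for all values of the data the posterior is a probability measure under which $\mu$ and $\Sigma$ are integrable (so the posterior means exist), and for every $\epsilon>0$ $$\lim_{K\to\infty}\mathbb{E}\big[\Pi_K\big(\|\mu_{PM}-\mu_0\|>\epsilon \mid L_1,\dots,L_K\big)\big]=0,$$ $$\lim_{K\to\infty}\mathbb{E}\big[\Pi_K\big(\|\Sigma_{PM}-\Sigma_0\|>\epsilon \mid L_1,\dots,L_K\big)\big]=0,$$ where the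 vector norm is Euclidean and the matrix norm is the Frobenius norm (any other norm gives an equivalent statement). -/

import Mathlib

open MeasureTheory ProbabilityTheory Filter Topology
open scoped ENNReal

namespace HierGauss

noncomputable section

/-- Mean vectors. -/
abbrev Vec (d : ℕ) : Type := EuclideanSpace ℝ (Fin d)

/-- Square real matrices. -/
abbrev Mat (d : ℕ) : Type := Matrix (Fin d) (Fin d) ℝ

/-- The product (equivalently, Borel) sigma-algebra on matrices. -/
instance instMeasurableSpaceMat (d : ℕ) : MeasurableSpace (Mat d) :=
  inferInstanceAs (MeasurableSpace (Fin d → Fin d → ℝ))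

/-- The parameter `θ = (μ, Σ, Σ_p)` of the hierarchical model. -/
abbrev Param (d : ℕ) : Type := Vec d × Mat d × Mat d

/-- Lebesgue measure on the symmetric `d × d` matrices in the `d (d + 1) / 2` coordinates
`σ_{ij} = σ_{ji}` (indexed by unordered pairs), seen as a measure on all `d × d` matrices. -/
def symVolume (d : ℕ) : Measure (Mat d) :=
  (volume : Measure (Sym2 (Fin d) → ℝ)).map
    (fun x => (Matrix.of fun i j => x s(i, j) : Mat d))

/-- The multivariate gamma function
`Γ_d(a) = π ^ (d (d - 1) / 4) * ∏_{i < d} Γ(a - i / 2)`. -/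
def multivariateGamma (d : ℕ) (a : ℝ) : ℝ :=
  Real.pi ^ ((d : ℝ) * ((d : ℝ) - 1) / 4) * ∏ i : Fin d, Real.Gamma (a - (i : ℝ) / 2)

open Classical in
/-- The density of the inverse Wishart distribution with scale matrix `Ψ` and `ν` degrees of
freedom, with respect to `symVolume`; it is carried by the positive definite matrices. -/
def invWishartDensity {d : ℕ} (Ψ : Mat d) (ν : ℝ) (S : Mat d) : ℝ :=
  if S.PosDef then
    Ψ.det ^ (ν / 2) / ((2 : ℝ) ^ (ν * d / 2) * multivariateGamma d (ν / 2))
      * S.det ^ (-(ν + d + 1) / 2) * Real.exp (-(1 / 2) * (Ψ * S⁻¹).trace)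
  else 0

/-- The inverse Wishart distribution (meant for `Ψ` positive definite and `ν > d - 1`). -/
def invWishart {d : ℕ} (Ψ : Mat d) (ν : ℝ) : Measure (Mat d) :=
  (symVolume d).withDensity (fun S => ENNReal.ofReal (invWishartDensity Ψ ν S))

/-- The Lebesgue density at `x` of the normal distribution `N_d(m, S)`, for `S` positive
definite. -/
def gaussianDensity {d : ℕ} (m : Vec d) (S : Mat d) (x : Vec d) : ℝ :=
  (2 * Real.pi) ^ (-(d : ℝ) / 2) * S.det ^ (-(1 / 2) : ℝ)
    * Real.exp (-(1 / 2) * ((x - m).ofLp ⬝ᵥ S⁻¹.mulVec (x - m).ofLp))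

/-- The hierarchical prior on `θ = (μ, Σ, Σ_p)`: `Σ ∼ IW(Ψ, ν)` and `Σ_p ∼ IW(Ψ_p, ν_p)` are
independent, and given them `μ ∼ N_d(α, Σ_p)`. -/
def prior {d : ℕ} (α : Vec d) (Ψ : Mat d) (ν : ℝ) (Ψp : Mat d) (νp : ℝ) : Measure (Param d) :=
  ((volume : Measure (Vec d)).prod ((invWishart Ψ ν).prod (invWishart Ψp νp))).withDensity
    (fun θ => ENNReal.ofReal (gaussianDensity α θ.2.2 θ.1))

/-- The likelihood at `θ = (μ, Σ, Σ_p)` of the first `K` observations `x 0, …, x (K - 1)`, which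
under `θ` are independent with `x j ∼ N_d(μ, Σ / (n j + 1 / 2))`. -/
def likelihood {d : ℕ} (n : ℕ → ℕ) (K : ℕ) (x : ℕ → Vec d) (θ : Param d) : ℝ :=
  ∏ j ∈ Finset.range K, gaussianDensity θ.1 (((n j : ℝ) + 1 / 2)⁻¹ • θ.2.1) (x j)

/-- The measure obtained from `π` by Bayes' formula: `dΠ ∝ ℓ dπ`, normalised to mass one. -/
def bayes {d : ℕ} (π : Measure (Param d)) (ℓ : Param d → ℝ) : Measure (Param d) :=
  (∫⁻ θ, ENNReal.ofReal (ℓ θ) ∂π)⁻¹ • π.withDensity (fun θ => ENNReal.ofReal (ℓ θ))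

/-- The posterior distribution `Π_K(· ∣ x 0, …, x (K - 1))` of `θ = (μ, Σ, Σ_p)` when the prior
distribution is `π`. -/
def posterior {d : ℕ} (π : Measure (Param d)) (n : ℕ → ℕ) (K : ℕ) (x : ℕ → Vec d) :
    Measure (Param d) :=
  bayes π (likelihood n K x)

/-- The mean of the first component `μ` of `θ`. -/
def meanMu {d : ℕ} (Q : Measure (Param d)) : Vec d := ∫ θ, θ.1 ∂Q

/-- The (entrywise) mean of the second component `Σ` of `θ`. -/
def meanSigma {d : ℕ} (Q : Measure (Param d)) : Mat d :=
  Matrix.of fun i j => ∫ θ, θ.2.1 i j ∂Q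

/-- The Frobenius norm (all norms on matrices of a fixed size are equivalent). -/
def matNorm {d : ℕ} (A : Mat d) : ℝ := √(∑ i, ∑ j, A i j ^ 2)

end

end HierGauss

/-! The proof rests on conjugacy. Integrating out Σ_p leaves μ with a multivariate t prior density
(`priorMu`, up to a constant). Given μ, likelihood times the prior of Σ is an inverse Wishart kernel
with ν + K degrees of freedom and scale Ψ + ∑ w_j (x_j − μ)(x_j − μ)ᵀ, where w_j = n_j + 1/2. With W
= ∑ w_j, m the weighted sample mean and A the scale matrix at m (`scatter`), this scale equals A + W
(μ − m)(μ − m)ᵀ. The matrix determinant lemma then makes the marginal posterior density of μ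
proportional to `priorMu` times (1 + q)^(−(ν+K)/2), where q(μ) = W (μ − m)ᵀ A⁻¹ (μ − m) is `mahal`.

Under the t kernel alone q has mean d/(ν + K − 2 − d). Since `priorMu` is at most 1 and bounded
below on {q ≤ 1}, the posterior mean of q is O(1/K) while m and tr A / W stay bounded
(`lintegral_mahal_muWeight_le`). Cauchy–Schwarz for A then puts μ_PM close to m. As the inverse
Wishart mean is scale/(ν + K − d − 1), the posterior mean of vᵀΣv is (vᵀAv + e)/(ν + K − d − 1) with
e at most vᵀAv times the bound on the mean of q (`exists_lintegral_quad`).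

So consistency follows deterministically from m → μ₀ and A/K → Σ₀. Both hold in probability, by
Chebyshev and the strong law, because the variables √w_j ⟨v, x_j − μ₀⟩ are i.i.d. centred Gaussian
whatever the batch sizes. `tendsto_measure_of_tendsto` transfers this to the posterior means. The
events in the theorem do not involve θ, so their posterior probability is 0 or 1.

The inverse Wishart facts are obtained without evaluating the multivariate gamma function: a
fictitious Gaussian observation x and Tonelli link m and m + 1 degrees of freedom
(`gaussMass_mul_iwMass`), which yields finiteness for m > d − 1 and the mean. -/

namespace HierGauss

open Matrix

/-! ### Quadratic forms, rank-one updates and square-root factors of positive definite matrices. -/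

section LinearAlgebra

variable {d : ℕ}

/-- Spectral decomposition of a positive definite matrix. -/
theorem exists_spectral {M : Mat d} (hM : M.PosDef) :
    ∃ (U : Mat d) (s : Fin d → ℝ), (∀ i, 0 < s i) ∧ U * Uᵀ = 1 ∧ Uᵀ * U = 1 ∧
      M = U * diagonal s * Uᵀ := by
  refine ⟨hM.isHermitian.eigenvectorUnitary, hM.isHermitian.eigenvalues, hM.eigenvalues_pos,
    ?_, ?_, ?_⟩
  · have := Unitary.coe_mul_star_self hM.isHermitian.eigenvectorUnitary
    simpa [star_eq_conjTranspose] using this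
  · have := Unitary.coe_star_mul_self hM.isHermitian.eigenvectorUnitary
    simpa [star_eq_conjTranspose] using this
  · have := hM.isHermitian.spectral_theorem
    simpa [Unitary.conjStarAlgAut_apply, star_eq_conjTranspose, Function.comp_def] using this

/-- The quadratic form `vᵀ S v`. -/
def quad (S : Mat d) (v : Vec d) : ℝ := v.ofLp ⬝ᵥ S *ᵥ v.ofLp

/-- The action of a matrix on vectors. -/
noncomputable def act (G : Mat d) : Vec d →ₗ[ℝ] Vec d := (toEuclideanLin (𝕜 := ℝ)) G

theorem act_ofLp (G : Mat d) (v : Vec d) : (act G v).ofLp = G *ᵥ v.ofLp := by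
  simp [act]

theorem inner_eq_dotProduct (v w : Vec d) : inner ℝ v w = v.ofLp ⬝ᵥ w.ofLp := by
  simp [EuclideanSpace.inner_eq_star_dotProduct, dotProduct_comm]

theorem norm_sq_eq_dotProduct (v : Vec d) : ‖v‖ ^ 2 = v.ofLp ⬝ᵥ v.ofLp := by
  rw [← real_inner_self_eq_norm_sq, inner_eq_dotProduct]

theorem quad_one (v : Vec d) : quad 1 v = ‖v‖ ^ 2 := by
  rw [norm_sq_eq_dotProduct, quad, one_mulVec]

theorem quad_mul_transpose (G : Mat d) (v : Vec d) : quad (G * Gᵀ) v = ‖act Gᵀ v‖ ^ 2 := by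
  rw [norm_sq_eq_dotProduct, act_ofLp, quad, ← mulVec_mulVec, dotProduct_mulVec, ← mulVec_transpose]

theorem inner_act (G : Mat d) (v w : Vec d) : inner ℝ v (act G w) = inner ℝ (act Gᵀ v) w := by
  rw [inner_eq_dotProduct, inner_eq_dotProduct, act_ofLp, act_ofLp, dotProduct_mulVec,
    ← mulVec_transpose]

theorem quad_inv_act {G : Mat d} (hG : G.det ≠ 0) (v : Vec d) :
    quad (G * Gᵀ)⁻¹ (act G v) = ‖v‖ ^ 2 := by
  have hu : IsUnit G.det := isUnit_iff_ne_zero.2 hG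
  have h : Gᵀ * ((G * Gᵀ)⁻¹ * G) = 1 := by
    rw [Matrix.mul_inv_rev, Matrix.mul_assoc, nonsing_inv_mul _ hu, Matrix.mul_one,
      mul_nonsing_inv _ (by rwa [det_transpose])]
  rw [norm_sq_eq_dotProduct, quad, act_ofLp, mulVec_mulVec, dotProduct_comm, dotProduct_mulVec,
    ← mulVec_transpose, mulVec_mulVec, h, one_mulVec]

/-- Here `s` holds square roots of eigenvalues. The factor is kept as orthogonal times diagonal
because the Jacobian of S ↦ G S Gᵀ is computed for these two kinds of matrices separately. -/
theorem exists_factor {M : Mat d} (hM : M.PosDef) :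
    ∃ (U : Mat d) (s : Fin d → ℝ), (∀ i, 0 < s i) ∧ U * Uᵀ = 1 ∧ Uᵀ * U = 1 ∧
      M = (U * diagonal s) * (U * diagonal s)ᵀ ∧ (U * diagonal s).det ≠ 0 := by
  obtain ⟨U, s, hs, h1, h2, h⟩ := exists_spectral hM
  have e : M = (U * diagonal fun i => √(s i)) * (U * diagonal fun i => √(s i))ᵀ := by
    rw [transpose_mul, diagonal_transpose, Matrix.mul_assoc, ← Matrix.mul_assoc (diagonal _),
      diagonal_mul_diagonal, ← Matrix.mul_assoc, h]
    congr; ext i; exact (Real.mul_self_sqrt (hs i).le).symm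
  refine ⟨U, fun i => √(s i), fun i => Real.sqrt_pos.2 (hs i), h1, h2, e, fun h0 => ?_⟩
  have := hM.det_pos
  rw [e, det_mul, h0] at this
  simp at this

theorem quad_add (S T : Mat d) (v : Vec d) : quad (S + T) v = quad S v + quad T v := by
  simp [quad, add_mulVec]

theorem quad_smul (c : ℝ) (S : Mat d) (v : Vec d) : quad (c • S) v = c * quad S v := by
  simp [quad, smul_mulVec]

/-- The rank one matrix `x xᵀ`. -/
def outer (x : Vec d) : Mat d := vecMulVec x.ofLp x.ofLp

theorem quad_outer (x v : Vec d) : quad (outer x) v = inner ℝ v x ^ 2 := by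
  rw [quad, outer, vecMulVec_mulVec, inner_eq_dotProduct]
  simp [dotProduct_comm, sq]

theorem trace_outer_mul (x : Vec d) (S : Mat d) : (outer x * S).trace = quad S x := by
  rw [outer, vecMulVec_mul, trace_vecMulVec, quad, dotProduct_mulVec, dotProduct_comm]

theorem quad_nonneg {S : Mat d} (hS : S.PosSemidef) (v : Vec d) : 0 ≤ quad S v := by
  simpa [quad] using hS.dotProduct_mulVec_nonneg v.ofLp

theorem posDef_iff_quad {S : Mat d} : S.PosDef ↔ S.IsSymm ∧ ∀ v : Vec d, v ≠ 0 → 0 < quad S v := by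
  rw [posDef_iff_dotProduct_mulVec]
  refine and_congr (by simp [IsHermitian, IsSymm]) ⟨fun h v hv => ?_, fun h v hv => ?_⟩
  · simpa [quad] using h (x := v.ofLp) (by simpa using hv)
  · simpa [quad] using h (WithLp.toLp 2 v) (by simpa using hv)

theorem outer_posSemidef (x : Vec d) : (outer x).PosSemidef := by
  simpa [outer] using posSemidef_vecMulVec_self_star x.ofLp

/-- This is what turns a power of the determinant of the posterior scale matrix into a t kernel in
μ. -/
theorem det_add_outer {M : Mat d} (hM : M.PosDef) (x : Vec d) :
    (M + outer x).det = M.det * (1 + quad M⁻¹ x) := by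
  have := det_add_replicateCol_mul_replicateRow (ι := Unit)
    ((isUnit_iff_isUnit_det M).1 hM.isUnit) x.ofLp x.ofLp
  rw [outer, vecMulVec_eq Unit, this, det_unique (n := Unit)]
  simp [quad, Matrix.mul_assoc, Matrix.mul_apply, dotProduct, mulVec]

/-- Cauchy–Schwarz for the pair of dual quadratic forms of a positive definite matrix. -/
theorem inner_sq_le_quad_mul {M : Mat d} (hM : M.PosDef) (v x : Vec d) :
    inner ℝ v x ^ 2 ≤ quad M v * quad M⁻¹ x := by
  obtain ⟨U, s, -, -, -, h, hdet⟩ := exists_factor hM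
  set G := U * diagonal s
  have hu : IsUnit G.det := isUnit_iff_ne_zero.2 hdet
  -- With M = G Gᵀ the claim becomes ordinary Cauchy–Schwarz for Gᵀ v and G⁻¹ x.
  have hx : x = act G (act G⁻¹ x) := by
    apply WithLp.ofLp_injective 2
    rw [act_ofLp, act_ofLp, mulVec_mulVec, mul_nonsing_inv _ hu, one_mulVec]
  rw [hx, inner_act, h, quad_mul_transpose, quad_inv_act hdet, ← mul_pow, ← sq_abs]
  gcongr
  exact abs_real_inner_le_norm _ _

theorem abs_quad_le (S : Mat d) (v : Vec d) : |quad S v| ≤ (∑ i, ∑ j, |S i j|) * ‖v‖ ^ 2 := by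
  simp only [quad, dotProduct, mulVec, Finset.mul_sum, Finset.sum_mul]
  refine (Finset.abs_sum_le_sum_abs _ _).trans (Finset.sum_le_sum fun i _ => ?_)
  refine (Finset.abs_sum_le_sum_abs _ _).trans (Finset.sum_le_sum fun j _ => ?_)
  rw [abs_mul, abs_mul]
  have hi := PiLp.norm_apply_le v i
  have hj := PiLp.norm_apply_le v j
  rw [Real.norm_eq_abs] at hi hj
  calc _ = |S i j| * (|v i| * |v j|) := by ring
    _ ≤ _ := by gcongr; rw [sq]; gcongr

end LinearAlgebra

/-! ### Measurability of matrix operations. -/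

section Measurability

variable {d : ℕ}

instance instBorelSpaceMat : BorelSpace (Mat d) :=
  inferInstanceAs (BorelSpace (Fin d → Fin d → ℝ))

theorem measurable_entry (i j : Fin d) : Measurable fun S : Mat d => S i j :=
  (measurable_pi_apply j).comp (measurable_pi_apply i)

theorem measurable_mat_iff {α : Type*} [MeasurableSpace α] {f : α → Mat d} :
    Measurable f ↔ ∀ i j, Measurable fun a => f a i j := by
  refine ⟨fun h i j => (measurable_entry i j).comp h, fun h => ?_⟩
  exact measurable_pi_lambda _ fun i => measurable_pi_lambda _ fun j => h i j

theorem measurable_det : Measurable fun S : Mat d => S.det :=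
  (Continuous.matrix_det continuous_id).measurable

theorem measurable_inv : Measurable fun S : Mat d => S⁻¹ := by
  simp only [Matrix.inv_def, Ring.inverse_eq_inv']
  rw [measurable_mat_iff]
  intro i j
  exact measurable_det.inv.mul ((measurable_entry i j).comp
    (Continuous.matrix_adjugate continuous_id).measurable)

theorem measurable_trace_mul {α : Type*} [MeasurableSpace α] {f g : α → Mat d} (hf : Measurable f)
    (hg : Measurable g) : Measurable fun a => (f a * g a).trace := by
  rw [measurable_mat_iff] at hf hg
  simp only [trace, diag_apply, mul_apply]
  fun_prop

theorem measurable_quad {α : Type*} [MeasurableSpace α] {f : α → Mat d} {g : α → Vec d}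
    (hf : Measurable f) (hg : Measurable g) : Measurable fun a => quad (f a) (g a) := by
  rw [measurable_mat_iff] at hf
  have hg' : ∀ i, Measurable fun a => g a i := fun i => by fun_prop
  simp only [quad, dotProduct, mulVec]
  fun_prop

theorem measurableSet_posDef : MeasurableSet {S : Mat d | S.PosDef} := by
  -- The positive semidefinite matrices form a closed set, whatever the number of vectors v;
  -- definiteness only adds invertibility.
  have h : {S : Mat d | S.PosDef} = {S | S.IsSymm} ∩ (⋂ v : Vec d, {S | 0 ≤ quad S v}) ∩
      {S | S.det ≠ 0} := by
    ext S
    simp only [Set.mem_ofPred_eq, Set.mem_inter_iff, Set.mem_iInter]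
    constructor
    · intro h
      exact ⟨⟨(posDef_iff_quad.1 h).1, quad_nonneg h.posSemidef⟩, h.det_pos.ne'⟩
    · rintro ⟨⟨h1, h2⟩, h3⟩
      have : S.PosSemidef := PosSemidef.of_dotProduct_mulVec_nonneg (by simpa [IsHermitian] using IsSymm.eq h1)
        fun x => by simpa [quad] using h2 (WithLp.toLp 2 x)
      exact (this.posDef_iff_isUnit).2 ((isUnit_iff_isUnit_det _).2 (isUnit_iff_ne_zero.2 h3))
  rw [h]
  refine MeasurableSet.inter (IsClosed.measurableSet ?_) (measurable_det (measurableSet_singleton 0).compl)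
  refine IsClosed.inter (isClosed_eq (by fun_prop) (by fun_prop)) (isClosed_iInter fun v => ?_)
  exact isClosed_le (by fun_prop) (by unfold quad; fun_prop)

end Measurability

/-! ### The Jacobian of S ↦ G S Gᵀ on symmetric matrices. -/

section Congruence

variable {d : ℕ}

/-- The symmetric matrix with given coordinates. -/
def symMat : (Sym2 (Fin d) → ℝ) →ₗ[ℝ] Mat d where
  toFun x := Matrix.of fun i j => x s(i, j)
  map_add' _ _ := rfl
  map_smul' _ _ := rfl

theorem symMat_apply (x : Sym2 (Fin d) → ℝ) (i j : Fin d) : symMat x i j = x s(i, j) := rfl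

theorem symMat_transpose (x : Sym2 (Fin d) → ℝ) : (symMat x)ᵀ = symMat x := by
  ext i j
  rw [transpose_apply, symMat_apply, symMat_apply, Sym2.eq_swap]

theorem measurable_symMat : Measurable (symMat (d := d)) :=
  measurable_mat_iff.2 fun _ _ => measurable_pi_apply _

theorem symVolume_eq : symVolume d = volume.map symMat := rfl

theorem lintegral_symVolume {F : Mat d → ℝ≥0∞} (hF : Measurable F) :
    ∫⁻ S, F S ∂symVolume d = ∫⁻ x, F (symMat x) := by
  rw [symVolume_eq, lintegral_map hF measurable_symMat]

instance instSFiniteSymVolume : SFinite (symVolume d) := by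
  rw [symVolume_eq]; infer_instance

/-- The map `S ↦ G S Gᵀ` in the coordinates of symmetric matrices. -/
def congrSym (G : Mat d) : (Sym2 (Fin d) → ℝ) →ₗ[ℝ] (Sym2 (Fin d) → ℝ) where
  toFun x σ := Sym2.lift ⟨fun i j => (G * symMat x * Gᵀ) i j, fun i j => by
    beta_reduce
    rw [← transpose_apply (G * symMat x * Gᵀ) i j, transpose_mul, transpose_mul, transpose_transpose,
      symMat_transpose, Matrix.mul_assoc]⟩ σ
  map_add' x y := by
    ext σ; induction σ with | _ i j => simp [Matrix.mul_add, Matrix.add_mul]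
  map_smul' c x := by
    ext σ; induction σ with | _ i j => simp

theorem symMat_congrSym (G : Mat d) (x : Sym2 (Fin d) → ℝ) :
    symMat (congrSym G x) = G * symMat x * Gᵀ := rfl

theorem symMat_injective : Function.Injective (symMat (d := d)) := by
  intro x y h
  ext σ
  induction σ with | _ i j => exact congrFun (congrFun h i) j

theorem congrSym_mul (G H : Mat d) : congrSym (G * H) = congrSym G ∘ₗ congrSym H := by
  refine LinearMap.ext fun x => symMat_injective ?_
  simp [symMat_congrSym, Matrix.mul_assoc]

/-- Each unordered pair is counted twice on the right: an off-diagonal one by its two orderings, a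
diagonal one once in each product. -/
theorem prod_sym2_sq {ι : Type*} [Fintype ι] [DecidableEq ι] (f : Sym2 ι → ℝ) :
    (∏ σ, f σ) ^ 2 = (∏ i, ∏ j, f s(i, j)) * ∏ i, f s(i, i) := by
  rw [← Fintype.prod_prod_type' (f := fun i j => f s(i, j)),
    ← Finset.prod_fiberwise (s := Finset.univ) (g := fun p : ι × ι => s(p.1, p.2)),
    ← Finset.prod_fiberwise (s := Finset.univ) (g := fun i : ι => s(i, i)),
    ← Finset.prod_mul_distrib, ← Finset.prod_pow]
  refine Finset.prod_congr rfl fun σ _ => ?_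
  have h1 : ∏ p : ι × ι with s(p.1, p.2) = σ, f s(p.1, p.2) =
      f σ ^ (Finset.univ.filter fun p : ι × ι => s(p.1, p.2) = σ).card := by
    rw [Finset.prod_congr rfl (g := fun _ => f σ), Finset.prod_const]
    intro p hp
    rw [(Finset.mem_filter.1 hp).2]
  have h2 : ∏ i : ι with s(i, i) = σ, f s(i, i) =
      f σ ^ (Finset.univ.filter fun i : ι => s(i, i) = σ).card := by
    rw [Finset.prod_congr rfl (g := fun _ => f σ), Finset.prod_const]
    intro p hp
    rw [(Finset.mem_filter.1 hp).2]
  rw [h1, h2, ← pow_add]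
  congr 1
  induction σ with | _ a b =>
  by_cases hab : a = b
  · subst hab
    have e1 : (Finset.univ.filter fun p : ι × ι => s(p.1, p.2) = s(a, a)) = {(a, a)} := by
      ext ⟨x, y⟩; simp
    have e2 : (Finset.univ.filter fun i : ι => s(i, i) = s(a, a)) = {a} := by
      ext x; simp
    rw [e1, e2]; rfl
  · have e1 : (Finset.univ.filter fun p : ι × ι => s(p.1, p.2) = s(a, b)) = {(a, b), (b, a)} := by
      ext ⟨x, y⟩; simp
    have e2 : (Finset.univ.filter fun i : ι => s(i, i) = s(a, b)) = ∅ := by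
      ext x
      simp only [Sym2.eq_iff, Finset.mem_filter, Finset.mem_univ, true_and, Finset.notMem_empty, iff_false]
      grind
    rw [e1, e2, Finset.card_pair (by simp [hab])]; rfl

/-- The map multiplies the coordinate {i, j} by s_i s_j. Comparing squares makes `prod_sym2_sq`
applicable without ordering the indices. -/
theorem abs_det_congrSym_diagonal (s : Fin d → ℝ) :
    |LinearMap.det (congrSym (diagonal s))| = |(diagonal s).det| ^ (d + 1) := by
  set w : Sym2 (Fin d) → ℝ := Sym2.lift ⟨fun i j => s i * s j, fun i j => mul_comm _ _⟩
  have h : congrSym (diagonal s) = toLin' (diagonal w) := by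
    refine LinearMap.ext fun x => symMat_injective ?_
    ext i j
    rw [symMat_congrSym, diagonal_transpose, mul_diagonal, diagonal_mul, symMat_apply, symMat_apply,
      toLin'_apply, mulVec_diagonal]
    simp only [w, Sym2.lift_mk]
    ring
  have hp : (∏ σ, w σ) ^ 2 = ((∏ i, s i) ^ (d + 1)) ^ 2 := by
    rw [prod_sym2_sq]
    simp only [w, Sym2.lift_mk, Finset.prod_mul_distrib, Finset.prod_const, Finset.prod_pow]
    simp only [Finset.card_univ, Fintype.card_fin]
    ring
  rw [h, LinearMap.det_toLin', det_diagonal, det_diagonal, ← abs_pow]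
  exact (sq_eq_sq_iff_abs_eq_abs _ _).1 hp

theorem sum_sq_congr {U : Mat d} (h : Uᵀ * U = 1) (X : Mat d) :
    ∑ i, ∑ j, (U * X * Uᵀ) i j ^ 2 = ∑ i, ∑ j, X i j ^ 2 := by
  have key : ∀ A : Mat d, ∑ i, ∑ j, A i j ^ 2 = (A * Aᵀ).trace := by
    intro A
    simp [trace, mul_apply, sq]
  rw [key, key, transpose_mul, transpose_mul, transpose_transpose]
  have : U * X * Uᵀ * (U * (Xᵀ * Uᵀ)) = U * (X * Xᵀ * Uᵀ) := by
    rw [Matrix.mul_assoc (U * X), ← Matrix.mul_assoc Uᵀ, h, Matrix.one_mul]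
    simp only [Matrix.mul_assoc]
  rw [this, trace_mul_comm, Matrix.mul_assoc, h, Matrix.mul_one]

/-- Conjugation by U preserves the Frobenius unit ball, whose volume is positive and finite, so its
determinant has absolute value 1. -/
theorem abs_det_congrSym_orthogonal {U : Mat d} (h1 : U * Uᵀ = 1) (h2 : Uᵀ * U = 1) :
    |LinearMap.det (congrSym U)| = |U.det| ^ (d + 1) := by
  have hU : |U.det| = 1 := by
    have := congrArg det h1
    rw [det_mul, det_transpose, det_one] at this
    rw [← sq_eq_sq₀ (abs_nonneg _) zero_le_one, sq_abs, sq, this, one_pow]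
  have hdet : LinearMap.det (congrSym U) ≠ 0 := by
    intro h0
    have : LinearMap.det (congrSym U ∘ₗ congrSym Uᵀ) = 1 := by
      rw [← congrSym_mul, h1]
      have : congrSym (1 : Mat d) = LinearMap.id :=
        LinearMap.ext fun x => symMat_injective (by simp [symMat_congrSym])
      rw [this, LinearMap.det_id]
    rw [LinearMap.det_comp, h0, zero_mul] at this
    exact zero_ne_one this
  set B : Set (Sym2 (Fin d) → ℝ) := {x | ∑ i, ∑ j, symMat x i j ^ 2 < 1}
  have hpre : congrSym U ⁻¹' B = B := by
    ext x
    simp only [B, Set.mem_preimage, Set.mem_ofPred_eq, symMat_congrSym, sum_sq_congr h2]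
  have hopen : IsOpen B := by
    simp only [B, symMat_apply]
    exact isOpen_lt (by fun_prop) continuous_const
  have hne : B.Nonempty := ⟨0, by simp [B]⟩
  have hpos : volume B ≠ 0 := (hopen.measure_pos volume hne).ne'
  have hfin : volume B ≠ ∞ := by
    refine ((Metric.isBounded_closedBall (x := (0 : Sym2 (Fin d) → ℝ)) (r := 1)).subset ?_).measure_lt_top.ne
    intro x hx
    rw [mem_closedBall_zero_iff, pi_norm_le_iff_of_nonneg zero_le_one]
    intro σ
    induction σ with | _ a b =>
    have h3 : x s(a, b) ^ 2 ≤ ∑ i, ∑ j, symMat x i j ^ 2 := by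
      refine le_trans ?_ (Finset.single_le_sum (f := fun i => ∑ j, symMat x i j ^ 2)
        (fun i _ => by positivity) (Finset.mem_univ a))
      exact Finset.single_le_sum (f := fun j => symMat x a j ^ 2)
        (fun i _ => by positivity) (Finset.mem_univ b)
    rw [Real.norm_eq_abs, ← sq_le_one_iff_abs_le_one]
    exact h3.trans (le_of_lt hx)
  have h := Measure.addHaar_preimage_linearMap volume hdet B
  rw [hpre] at h
  have h3 : ENNReal.ofReal |(LinearMap.det (congrSym U))⁻¹| = 1 := by
    rw [← ENNReal.mul_left_inj hpos hfin, one_mul, ← h]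
  rw [hU, one_pow]
  rw [ENNReal.ofReal_eq_one, abs_inv, inv_eq_one] at h3
  exact h3

theorem lintegral_congr_symVolume {U : Mat d} {s : Fin d → ℝ} (hs : ∀ i, 0 < s i)
    (h1 : U * Uᵀ = 1) (h2 : Uᵀ * U = 1) {F : Mat d → ℝ≥0∞} (hF : Measurable F) :
    ∫⁻ S, F S ∂symVolume d = ENNReal.ofReal (|(U * diagonal s).det| ^ (d + 1)) *
      ∫⁻ S, F (U * diagonal s * S * (U * diagonal s)ᵀ) ∂symVolume d := by
  set G := U * diagonal s
  have hdet : |LinearMap.det (congrSym G)| = |G.det| ^ (d + 1) := by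
    rw [congrSym_mul, LinearMap.det_comp, abs_mul, abs_det_congrSym_diagonal,
      abs_det_congrSym_orthogonal h1 h2, ← mul_pow, ← abs_mul, ← det_mul]
  have hG : G.det ≠ 0 := by
    rw [det_mul, det_diagonal]
    refine mul_ne_zero (fun h => ?_) (Finset.prod_ne_zero_iff.2 fun i _ => (hs i).ne')
    have := congrArg det h1
    rw [det_mul, h] at this
    simp at this
  have hne : LinearMap.det (congrSym G) ≠ 0 := by
    rw [← abs_pos, hdet]; positivity
  have hmeas : Measurable fun S : Mat d => G * S * Gᵀ :=
    Continuous.measurable (by fun_prop)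
  rw [lintegral_symVolume hF, lintegral_symVolume (F := fun S => F (G * S * Gᵀ)) (hF.comp hmeas)]
  have h := Measure.map_linearMap_addHaar_eq_smul_addHaar volume hne
  have h3 : ∫⁻ x, F (symMat (congrSym G x)) =
      ENNReal.ofReal (|G.det| ^ (d + 1))⁻¹ * ∫⁻ x, F (symMat x) := by
    rw [← lintegral_map (μ := volume) (f := fun x => F (symMat x)) (hF.comp measurable_symMat)
      (LinearMap.continuous_of_finiteDimensional _).measurable, h, lintegral_smul_measure, abs_inv,
      hdet, smul_eq_mul]
  simp only [symMat_congrSym] at h3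
  have hp : 0 < |G.det| ^ (d + 1) := by positivity
  rw [h3, ← mul_assoc, ← ENNReal.ofReal_mul hp.le, mul_inv_cancel₀ hp.ne', ENNReal.ofReal_one,
    one_mul]

end Congruence

/-! ### The inverse Wishart kernel and how its mass scales. -/

section Kernel

variable {d : ℕ}

open Classical in
/-- The unnormalised inverse Wishart density with `m` degrees of freedom and scale matrix `M`. -/
noncomputable def iwKernel (m : ℝ) (M S : Mat d) : ℝ :=
  if S.PosDef then S.det ^ (-(m + d + 1) / 2) * Real.exp (-(1 / 2) * (M * S⁻¹).trace) else 0

theorem iwKernel_of_posDef {m : ℝ} {M S : Mat d} (h : S.PosDef) :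
    iwKernel m M S = S.det ^ (-(m + d + 1) / 2) * Real.exp (-(1 / 2) * (M * S⁻¹).trace) := if_pos h

theorem iwKernel_of_not_posDef {m : ℝ} {M S : Mat d} (h : ¬ S.PosDef) : iwKernel m M S = 0 :=
  if_neg h

theorem iwKernel_nonneg (m : ℝ) (M S : Mat d) : 0 ≤ iwKernel m M S := by
  by_cases h : S.PosDef
  · rw [iwKernel_of_posDef h]
    have := h.det_pos
    positivity
  · rw [iwKernel_of_not_posDef h]

theorem measurable_iwKernel {α : Type*} [MeasurableSpace α] (m : ℝ) {f g : α → Mat d}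
    (hf : Measurable f) (hg : Measurable g) : Measurable fun a => iwKernel m (f a) (g a) := by
  refine Measurable.ite (hg measurableSet_posDef) ?_ measurable_const
  exact ((measurable_det.comp hg).pow_const _).mul
    ((measurable_trace_mul hf (measurable_inv.comp hg)).const_mul _).exp

/-- The normalising constant of `iwKernel`. -/
noncomputable def iwMass (m : ℝ) (M : Mat d) : ℝ≥0∞ :=
  ∫⁻ S, ENNReal.ofReal (iwKernel m M S) ∂symVolume d

theorem iwKernel_congr (m : ℝ) {G : Mat d} (hG : G.det ≠ 0) (S : Mat d) :
    iwKernel m (G * Gᵀ) (G * S * Gᵀ) = |G.det| ^ (-(m + d + 1)) * iwKernel m 1 S := by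
  have hu : IsUnit G.det := isUnit_iff_ne_zero.2 hG
  have hu' : IsUnit Gᵀ.det := by rwa [det_transpose]
  have hiff : (G * S * Gᵀ).PosDef ↔ S.PosDef := by
    have := Matrix.IsUnit.posDef_star_right_conjugate_iff ((isUnit_iff_isUnit_det G).2 hu) (x := S)
    rw [star_eq_conjTranspose, conjTranspose_eq_transpose_of_trivial] at this
    exact this
  by_cases h : S.PosDef
  · rw [iwKernel_of_posDef h, iwKernel_of_posDef (hiff.2 h)]
    have e1 : (G * S * Gᵀ).det = |G.det| ^ (2 : ℝ) * S.det := by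
      rw [det_mul, det_mul, det_transpose, Real.rpow_two, sq_abs]; ring
    have e2 : (G * Gᵀ * (G * S * Gᵀ)⁻¹).trace = (1 * S⁻¹).trace := by
      rw [Matrix.mul_inv_rev, Matrix.mul_inv_rev, Matrix.mul_assoc, ← Matrix.mul_assoc Gᵀ,
        mul_nonsing_inv _ hu', Matrix.one_mul, ← Matrix.mul_assoc, trace_mul_comm,
        ← Matrix.mul_assoc, nonsing_inv_mul _ hu]
    have hp : 0 < |G.det| := abs_pos.2 hG
    rw [e1, e2, Real.mul_rpow (by positivity) h.det_pos.le, ← Real.rpow_mul hp.le, mul_assoc]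
    congr 2
    ring
  · rw [iwKernel_of_not_posDef h, iwKernel_of_not_posDef (mt hiff.1 h), mul_zero]

/-- Substitute S = G S' Gᵀ with M = G Gᵀ: the kernel contributes |det G|^(−(m+d+1)) and the Jacobian
|det G|^(d+1), leaving |det G|^(−m). -/
theorem iwMass_eq (m : ℝ) {M : Mat d} (hM : M.PosDef) :
    iwMass m M = ENNReal.ofReal (M.det ^ (-m / 2)) * iwMass m (1 : Mat d) := by
  obtain ⟨U, s, hs, h1, h2, h, hdet⟩ := exists_factor hM
  have hp : 0 < |(U * diagonal s).det| := abs_pos.2 hdet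
  have hk : Measurable fun S : Mat d => ENNReal.ofReal (iwKernel m M S) :=
    (measurable_iwKernel m measurable_const measurable_id).ennreal_ofReal
  rw [iwMass, lintegral_congr_symVolume hs h1 h2 hk]
  simp only [h]
  set G := U * diagonal s
  rw [det_mul G, det_transpose]
  simp only [iwKernel_congr m hdet]
  rw [iwMass, ← lintegral_const_mul, ← lintegral_const_mul]
  · refine lintegral_congr fun S => ?_
    rw [← ENNReal.ofReal_mul (by positivity),
      ← ENNReal.ofReal_mul (Real.rpow_nonneg (mul_self_nonneg _) _), ← mul_assoc]
    congr 2
    rw [← abs_mul_abs_self G.det, Real.mul_rpow hp.le hp.le, ← Real.rpow_natCast,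
      ← Real.rpow_add hp, ← Real.rpow_add hp]
    congr 1
    push_cast
    ring
  · exact (measurable_iwKernel m measurable_const measurable_id).ennreal_ofReal
  · exact ((measurable_iwKernel m measurable_const measurable_id).const_mul _).ennreal_ofReal

/-- The kernel is positive on an open neighbourhood of the identity, where S − 1 perturbs ‖v‖² by
less than itself. -/
theorem iwMass_one_ne_zero (m : ℝ) : iwMass m (1 : Mat d) ≠ 0 := by
  have hk : Measurable fun S : Mat d => ENNReal.ofReal (iwKernel m 1 S) :=
    (measurable_iwKernel m measurable_const measurable_id).ennreal_ofReal
  rw [iwMass, lintegral_symVolume hk]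
  set O : Set (Sym2 (Fin d) → ℝ) := {x | ∑ i, ∑ j, |symMat x i j - (1 : Mat d) i j| < 1}
  have hO : IsOpen O := by
    simp only [O, symMat_apply]
    exact isOpen_lt (by fun_prop) continuous_const
  have hne : O.Nonempty := by
    refine ⟨Sym2.lift ⟨fun i j => (1 : Mat d) i j, fun i j => by simp [one_apply, eq_comm]⟩, ?_⟩
    simp [O, symMat_apply]
  have hpd : ∀ x ∈ O, (symMat x).PosDef := by
    intro x hx
    refine posDef_iff_quad.2 ⟨symMat_transpose x, fun v hv => ?_⟩
    have e : quad (symMat x) v = ‖v‖ ^ 2 + quad (symMat x - 1) v := by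
      rw [← quad_one, ← quad_add, add_sub_cancel]
    have hb : |quad (symMat x - 1) v| ≤ (∑ i, ∑ j, |symMat x i j - (1 : Mat d) i j|) * ‖v‖ ^ 2 :=
      abs_quad_le _ v
    have hv2 : 0 < ‖v‖ ^ 2 := by positivity
    have h3 : (∑ i, ∑ j, |symMat x i j - (1 : Mat d) i j|) * ‖v‖ ^ 2 < ‖v‖ ^ 2 :=
      mul_lt_of_lt_one_left hv2 hx
    have := neg_abs_le (quad (symMat x - 1) v)
    linarith
  intro h0
  have h0' := (lintegral_eq_zero_iff (hk.comp measurable_symMat)).1 h0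
  refine (hO.measure_pos volume hne).ne' (measure_mono_null (fun x hx => ?_) h0')
  have h := hpd x hx
  have := h.det_pos
  simp only [Set.mem_compl_iff, Set.mem_ofPred_eq, Function.comp_apply, Pi.zero_apply,
    ENNReal.ofReal_eq_zero, not_le, iwKernel_of_posDef h]
  positivity

end Kernel

/-! ### Integrals of radial functions; moments of Gaussian and t kernels. -/

section Euclidean

variable {d : ℕ}

theorem det_act (G : Mat d) : LinearMap.det (act G) = G.det := by
  rw [act, toEuclideanLin_eq_toLin_orthonormal, LinearMap.det_toLin]

theorem measurable_act (G : Mat d) : Measurable (act G) :=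
  (LinearMap.continuous_of_finiteDimensional _).measurable

theorem lintegral_act {G : Mat d} (hG : G.det ≠ 0) {F : Vec d → ℝ≥0∞} (hF : Measurable F) :
    ∫⁻ x, F x = ENNReal.ofReal |G.det| * ∫⁻ y, F (act G y) := by
  have hne : LinearMap.det (act G) ≠ 0 := by rwa [det_act]
  have hp : 0 < |G.det| := abs_pos.2 hG
  rw [← lintegral_map hF (measurable_act G),
    Measure.map_linearMap_addHaar_eq_smul_addHaar volume hne, lintegral_smul_measure, det_act,
    abs_inv, smul_eq_mul, ← mul_assoc, ← ENNReal.ofReal_mul hp.le, mul_inv_cancel₀ hp.ne',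
    ENNReal.ofReal_one, one_mul]

theorem lintegral_smul_vec {c : ℝ} (hc : 0 < c) {F : Vec d → ℝ≥0∞} (hF : Measurable F) :
    ∫⁻ y, F (c • y) = ENNReal.ofReal (c ^ d)⁻¹ * ∫⁻ x, F x := by
  rw [← lintegral_map hF (measurable_const_smul c), Measure.map_addHaar_smul volume hc.ne',
    lintegral_smul_measure, finrank_euclideanSpace_fin, abs_of_nonneg (by positivity), smul_eq_mul]

/-- Second moments of radial functions are isotropic. -/
theorem lintegral_inner_sq_radial (hd : 1 ≤ d) {g : ℝ → ℝ≥0∞} (hg : Measurable g) (u : Vec d) :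
    ∫⁻ y, ENNReal.ofReal (inner ℝ u y ^ 2) * g (‖y‖ ^ 2) =
      ENNReal.ofReal (‖u‖ ^ 2 / d) * ∫⁻ y : Vec d, ENNReal.ofReal (‖y‖ ^ 2) * g (‖y‖ ^ 2) := by
  have key : ∀ i : Fin d, ∫⁻ y, ENNReal.ofReal (inner ℝ u y ^ 2) * g (‖y‖ ^ 2) =
      ENNReal.ofReal (‖u‖ ^ 2) * ∫⁻ y : Vec d, ENNReal.ofReal (y i ^ 2) * g (‖y‖ ^ 2) := by
    intro i
    -- A reflection carries u to ‖u‖ e_i, so every coordinate gives the same second moment; summing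
    -- over i then produces ‖y‖² and the factor 1/d.
    set w : Vec d := ‖u‖ • EuclideanSpace.single i (1 : ℝ)
    have hw : ‖u‖ = ‖w‖ := by simp [w, norm_smul]
    set R := (ℝ ∙ (u - w))ᗮ.reflection
    have hR : R u = w := Submodule.reflection_sub hw
    have h := R.measurePreserving.lintegral_comp
      (f := fun y => ENNReal.ofReal (inner ℝ w y ^ 2) * g (‖y‖ ^ 2)) (by fun_prop)
    rw [← lintegral_const_mul _ (by fun_prop)]
    have h2 : ∀ y, inner ℝ w (R y) = inner ℝ u y := fun y => by
      rw [← hR, R.inner_map_map]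
    simp only [h2, R.norm_map] at h
    rw [h]
    refine lintegral_congr fun y => ?_
    rw [← mul_assoc, ← ENNReal.ofReal_mul (by positivity), ← mul_pow]
    simp [w, real_inner_smul_left, EuclideanSpace.inner_single_left]
  have hd0 : (0 : ℝ) < d := by exact_mod_cast hd
  have hsum : (d : ℝ≥0∞) * ∫⁻ y, ENNReal.ofReal (inner ℝ u y ^ 2) * g (‖y‖ ^ 2) =
      ENNReal.ofReal (‖u‖ ^ 2) * ∫⁻ y : Vec d, ENNReal.ofReal (‖y‖ ^ 2) * g (‖y‖ ^ 2) := by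
    have : (d : ℝ≥0∞) * ∫⁻ y, ENNReal.ofReal (inner ℝ u y ^ 2) * g (‖y‖ ^ 2) =
        ∑ i : Fin d, ENNReal.ofReal (‖u‖ ^ 2) *
          ∫⁻ y : Vec d, ENNReal.ofReal (y i ^ 2) * g (‖y‖ ^ 2) := by
      rw [← Finset.sum_congr rfl fun i _ => key i]; simp
    rw [this, ← Finset.mul_sum, ← lintegral_finsetSum _ (fun i _ => by fun_prop)]
    congr 1
    refine lintegral_congr fun y => ?_
    rw [← Finset.sum_mul, ← ENNReal.ofReal_sum_of_nonneg (fun i _ => sq_nonneg _),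
      EuclideanSpace.real_norm_sq_eq]
  have hdt : ENNReal.ofReal (1 / d) * (d : ℝ≥0∞) = 1 := by
    rw [← ENNReal.ofReal_natCast d, ← ENNReal.ofReal_mul (by positivity), one_div,
      inv_mul_cancel₀ hd0.ne', ENNReal.ofReal_one]
  rw [← one_mul (lintegral _ _), ← hdt, mul_assoc, hsum, ← mul_assoc,
    ← ENNReal.ofReal_mul (by positivity)]
  congr 2
  ring

theorem abs_det_factor {M G : Mat d} (h : M = G * Gᵀ) : |G.det| = M.det ^ (1 / 2 : ℝ) := by
  rw [h, det_mul, det_transpose, ← Real.sqrt_eq_rpow, Real.sqrt_mul_self_eq_abs]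

theorem lintegral_quad_inv {M : Mat d} (hM : M.PosDef) {g : ℝ → ℝ≥0∞} (hg : Measurable g) :
    ∫⁻ x, g (quad M⁻¹ x) =
      ENNReal.ofReal (M.det ^ (1 / 2 : ℝ)) * ∫⁻ y : Vec d, g (‖y‖ ^ 2) := by
  obtain ⟨U, s, -, -, -, h, hdet⟩ := exists_factor hM
  rw [lintegral_act (F := fun x => g (quad M⁻¹ x)) hdet
    (hg.comp (measurable_quad measurable_const measurable_id)), abs_det_factor h]
  simp only [h, quad_inv_act hdet]

theorem lintegral_inner_sq_quad_inv (hd : 1 ≤ d) {M : Mat d} (hM : M.PosDef) {g : ℝ → ℝ≥0∞}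
    (hg : Measurable g) (v : Vec d) :
    ∫⁻ x, ENNReal.ofReal (inner ℝ v x ^ 2) * g (quad M⁻¹ x) =
      ENNReal.ofReal (M.det ^ (1 / 2 : ℝ)) * (ENNReal.ofReal (quad M v / d) *
        ∫⁻ y : Vec d, ENNReal.ofReal (‖y‖ ^ 2) * g (‖y‖ ^ 2)) := by
  obtain ⟨U, s, -, -, -, h, hdet⟩ := exists_factor hM
  have hm : Measurable fun x : Vec d => ENNReal.ofReal (inner ℝ v x ^ 2) * g (quad M⁻¹ x) :=
    Measurable.mul (by fun_prop) (hg.comp (measurable_quad measurable_const measurable_id))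
  rw [lintegral_act hdet hm, abs_det_factor h]
  simp only [h, quad_inv_act hdet, inner_act, quad_mul_transpose]
  rw [lintegral_inner_sq_radial hd hg]

/-- Integration by parts for radial functions. -/
theorem lintegral_radial_of_deriv (hd : 1 ≤ d) {G k : ℝ → ℝ} (hk : Measurable k)
    (hk0 : ∀ r, 0 < r → 0 ≤ k r) (hG : ∀ r, 0 < r → HasDerivAt G (-k r) r)
    (hlim : Tendsto G atTop (𝓝 0)) :
    ∫⁻ y : Vec d, ENNReal.ofReal (G (‖y‖ ^ 2)) =
      ENNReal.ofReal (2 / d) * ∫⁻ y : Vec d, ENNReal.ofReal (‖y‖ ^ 2 * k (‖y‖ ^ 2)) := by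
  have hd0 : (0 : ℝ) < d := by exact_mod_cast hd
  -- G(r) is minus the integral of its derivative along the ray s ↦ s r, s ≥ 1. After Tonelli,
  -- rescaling y by √s gives s^(−d/2−1), whose integral over (1, ∞) is 2/d.
  have h1 : ∀ r, 0 < r → ENNReal.ofReal (G r) =
      ∫⁻ s in Set.Ioi (1 : ℝ), ENNReal.ofReal (r * k (s * r)) := by
    intro r hr
    have hder : ∀ s ∈ Set.Ici (1 : ℝ), HasDerivAt (fun s => -G (s * r)) (r * k (s * r)) s := by
      intro s hs
      have hs0 : 0 < s := lt_of_lt_of_le one_pos hs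
      have := ((hG (s * r) (by positivity)).comp s ((hasDerivAt_id s).mul_const r)).neg
      convert! this using 1
      ring
    have hpos : ∀ s ∈ Set.Ioi (1 : ℝ), 0 ≤ r * k (s * r) := fun s hs =>
      mul_nonneg hr.le (hk0 _ (mul_pos (lt_trans one_pos hs) hr))
    have hl : Tendsto (fun s => -G (s * r)) atTop (𝓝 0) := by
      simpa using (hlim.comp (tendsto_id.atTop_mul_const hr)).neg
    have e1 := integral_Ioi_of_hasDerivAt_of_nonneg' hder hpos hl
    have e2 := integrableOn_Ioi_deriv_of_nonneg' hder hpos hl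
    rw [← ofReal_integral_eq_lintegral_ofReal e2
      ((ae_restrict_iff' measurableSet_Ioi).2 (ae_of_all _ hpos)), e1]
    simp
  -- The representation of G needs r > 0, so y = 0 must be discarded; a point is null only in
  -- positive dimension.
  have : Nonempty (Fin d) := ⟨⟨0, hd⟩⟩
  have h2 : ∫⁻ y : Vec d, ENNReal.ofReal (G (‖y‖ ^ 2)) =
      ∫⁻ y : Vec d, ∫⁻ s in Set.Ioi (1 : ℝ), ENNReal.ofReal (‖y‖ ^ 2 * k (s * ‖y‖ ^ 2)) := by
    refine lintegral_congr_ae ?_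
    filter_upwards [Measure.ae_ne volume (0 : Vec d)] with y hy
    exact h1 _ (by positivity)
  rw [h2, lintegral_lintegral_swap (by fun_prop)]
  set X := ∫⁻ y : Vec d, ENNReal.ofReal (‖y‖ ^ 2 * k (‖y‖ ^ 2))
  have h3 : ∀ s ∈ Set.Ioi (1 : ℝ), ∫⁻ y : Vec d, ENNReal.ofReal (‖y‖ ^ 2 * k (s * ‖y‖ ^ 2)) =
      ENNReal.ofReal (s ^ (-(d : ℝ) / 2 - 1)) * X := by
    intro s hs
    have hs0 : (0 : ℝ) < s := lt_trans one_pos hs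
    have e := lintegral_smul_vec (d := d) (Real.sqrt_pos.2 hs0)
      (F := fun y => ENNReal.ofReal (‖y‖ ^ 2 * k (‖y‖ ^ 2))) (by fun_prop)
    simp only [norm_smul, mul_pow, Real.norm_eq_abs, sq_abs, Real.sq_sqrt hs0.le] at e
    have e' : ∫⁻ y : Vec d, ENNReal.ofReal (‖y‖ ^ 2 * k (s * ‖y‖ ^ 2)) =
        ENNReal.ofReal s⁻¹ * ∫⁻ y : Vec d, ENNReal.ofReal (s * ‖y‖ ^ 2 * k (s * ‖y‖ ^ 2)) := by
      rw [← lintegral_const_mul _ (by fun_prop)]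
      refine lintegral_congr fun y => ?_
      rw [← ENNReal.ofReal_mul (by positivity)]
      congr 1
      field_simp
    rw [e', e, ← mul_assoc, ← ENNReal.ofReal_mul (by positivity)]
    congr 2
    rw [Real.sqrt_eq_rpow, ← Real.rpow_natCast, ← Real.rpow_mul hs0.le, ← Real.rpow_neg hs0.le,
      ← Real.rpow_neg_one, ← Real.rpow_add hs0]
    congr 1
    ring
  rw [setLIntegral_congr_fun measurableSet_Ioi h3, lintegral_mul_const _ (by fun_prop)]
  congr 1
  have ha : -(d : ℝ) / 2 - 1 < -1 := by linarith
  rw [← ofReal_integral_eq_lintegral_ofReal (integrableOn_Ioi_rpow_of_lt ha one_pos)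
    ((ae_restrict_iff' measurableSet_Ioi).2 (ae_of_all _ fun s hs =>
      Real.rpow_nonneg (lt_trans one_pos hs).le _)), integral_Ioi_rpow_of_lt ha one_pos]
  congr 1
  rw [Real.one_rpow, show -(d : ℝ) / 2 - 1 + 1 = -(d / 2) by ring, neg_div_neg_eq, one_div_div]

variable (d) in
/-- The mass of the standard Gaussian kernel. -/
noncomputable def gaussMass : ℝ≥0∞ := ∫⁻ y : Vec d, ENNReal.ofReal (Real.exp (-(1 / 2) * ‖y‖ ^ 2))

theorem lintegral_norm_sq_gauss (hd : 1 ≤ d) :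
    ∫⁻ y : Vec d, ENNReal.ofReal (‖y‖ ^ 2) * ENNReal.ofReal (Real.exp (-(1 / 2) * ‖y‖ ^ 2)) =
      d * gaussMass d := by
  have hd0 : (0 : ℝ) < d := by exact_mod_cast hd
  have h := lintegral_radial_of_deriv hd (G := fun r => Real.exp (-(1 / 2) * r))
    (k := fun r => 1 / 2 * Real.exp (-(1 / 2) * r)) (by fun_prop) (fun r _ => by positivity)
    (fun r _ => by
      convert! ((hasDerivAt_id r).const_mul (-(1 / 2) : ℝ)).exp using 1
      simp; ring)
    (Real.tendsto_exp_atBot.comp (tendsto_id.const_mul_atTop_of_neg (by norm_num)))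
  rw [gaussMass, h, ← ENNReal.ofReal_natCast d, ← mul_assoc, ← ENNReal.ofReal_mul (by positivity),
    ← lintegral_const_mul _ (by fun_prop)]
  refine lintegral_congr fun y => ?_
  rw [← ENNReal.ofReal_mul (by positivity), ← ENNReal.ofReal_mul (by positivity)]
  congr 1
  field_simp

theorem gaussMass_ne_zero : gaussMass d ≠ 0 := by
  rw [gaussMass, Ne, lintegral_eq_zero_iff (by fun_prop)]
  intro h
  have : ∀ᵐ y : Vec d, False := by
    filter_upwards [h] with y hy
    simp only [Pi.zero_apply, ENNReal.ofReal_eq_zero] at hy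
    exact absurd hy (not_le.2 (Real.exp_pos _))
  rw [eventually_false_iff_eq_bot, ae_eq_bot] at this
  exact NeZero.ne (volume : Measure (Vec d)) this

variable (d) in
/-- The mass of the kernel `(1 + ‖y‖²) ^ (-a)`. -/
noncomputable def tMass (a : ℝ) : ℝ≥0∞ := ∫⁻ y : Vec d, ENNReal.ofReal ((1 + ‖y‖ ^ 2) ^ (-a))

theorem tMass_ne_top {a : ℝ} (ha : (d : ℝ) < 2 * a) : tMass d a ≠ ∞ := by
  have h := integrable_rpow_neg_one_add_norm_sq (E := Vec d) (μ := volume) (r := 2 * a)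
    (by simpa using ha)
  have e : ∀ y : Vec d, (1 + ‖y‖ ^ 2) ^ (-(2 * a) / 2) = (1 + ‖y‖ ^ 2) ^ (-a) := fun y => by
    congr 1; ring
  simp only [e] at h
  exact h.lintegral_lt_top.ne

/-- Let X be the second moment and J the mass. Splitting 1 + ‖y‖² gives `tMass d (a - 1)` = X + J,
and integration by parts gives 2(a − 1)/d · X for the same quantity; solve for X. The hypothesis on
a makes all terms finite. -/
theorem lintegral_norm_sq_t (hd : 1 ≤ d) {a : ℝ} (ha : (d : ℝ) + 2 < 2 * a) :
    ∫⁻ y : Vec d, ENNReal.ofReal (‖y‖ ^ 2) * ENNReal.ofReal ((1 + ‖y‖ ^ 2) ^ (-a)) =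
      ENNReal.ofReal (d / (2 * a - 2 - d)) * tMass d a := by
  have hd0 : (0 : ℝ) < d := by exact_mod_cast hd
  set X := ∫⁻ y : Vec d, ENNReal.ofReal (‖y‖ ^ 2) * ENNReal.ofReal ((1 + ‖y‖ ^ 2) ^ (-a))
  have hfin : tMass d (a - 1) ≠ ∞ := tMass_ne_top (by linarith)
  have h1 : tMass d (a - 1) = X + tMass d a := by
    rw [tMass, tMass, ← lintegral_add_right _ (by fun_prop)]
    refine lintegral_congr fun y => ?_
    rw [← ENNReal.ofReal_mul (by positivity), ← ENNReal.ofReal_add (by positivity) (by positivity)]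
    congr 1
    rw [show -(a - 1) = 1 + -a by ring, Real.rpow_add (by positivity), Real.rpow_one]
    ring
  have h2 : tMass d (a - 1) = ENNReal.ofReal (2 * (a - 1) / d) * X := by
    have h := lintegral_radial_of_deriv hd (G := fun r => (1 + r) ^ (-(a - 1)))
      (k := fun r => (a - 1) * (1 + r) ^ (-a)) (by fun_prop)
      (fun r hr => mul_nonneg (by linarith) (by positivity))
      (fun r hr => by
        convert! ((hasDerivAt_id r).const_add 1).rpow_const (p := -(a - 1))
          (Or.inl (by simp; positivity)) using 1
        simp only [id]
        rw [show -(a - 1) - 1 = -a by ring]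
        ring)
      ((tendsto_rpow_neg_atTop (by linarith)).comp (tendsto_atTop_add_const_left _ 1 tendsto_id))
    rw [tMass, h, show 2 * (a - 1) / d = 2 / d * (a - 1) by ring,
      ENNReal.ofReal_mul (by positivity), mul_assoc]
    congr 1
    rw [← lintegral_const_mul _ (by fun_prop)]
    refine lintegral_congr fun y => ?_
    rw [← ENNReal.ofReal_mul (by positivity), ← ENNReal.ofReal_mul (by linarith)]
    congr 1
    ring
  have hX : X ≠ ∞ := fun h => hfin (by rw [h1, h, top_add])
  have hJ : tMass d a ≠ ∞ := tMass_ne_top (by linarith)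
  rw [h2] at h1
  have h3 := congrArg ENNReal.toReal h1
  have hc : 0 ≤ 2 * (a - 1) / d := div_nonneg (by linarith) hd0.le
  rw [ENNReal.toReal_mul, ENNReal.toReal_ofReal hc, ENNReal.toReal_add hX hJ] at h3
  have hc' : 0 < 2 * a - 2 - d := by linarith
  rw [← ENNReal.ofReal_toReal hX, ← ENNReal.ofReal_toReal hJ, ← ENNReal.ofReal_mul (by positivity)]
  congr 1
  rw [div_mul_eq_mul_div, eq_div_iff hc'.ne']
  field_simp at h3
  linear_combination h3

end Euclidean

/-! ### Matrix entries from quadratic forms. -/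

section Polarization

variable {d : ℕ}

theorem quad_single (S : Mat d) (i : Fin d) : quad S (EuclideanSpace.single i 1) = S i i := by
  simp [quad]

theorem quad_add_single {S : Mat d} (hS : S.IsSymm) (i j : Fin d) :
    quad S (EuclideanSpace.single i 1 + EuclideanSpace.single j 1) =
      S i i + S j j + 2 * S i j := by
  have : S j i = S i j := hS.apply i j
  simp [quad, mulVec_add, this]
  ring

theorem quad_sub_single {S : Mat d} (hS : S.IsSymm) (i j : Fin d) :
    quad S (EuclideanSpace.single i 1 - EuclideanSpace.single j 1) =
      S i i + S j j - 2 * S i j := by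
  have : S j i = S i j := hS.apply i j
  simp [quad, mulVec_sub, this]
  ring

theorem abs_entry_le {S : Mat d} (hS : S.PosSemidef) (i j : Fin d) :
    |S i j| ≤ (S i i + S j j) / 2 := by
  have hs : S.IsSymm := by simpa [IsHermitian, IsSymm] using hS.isHermitian
  have h1 := quad_nonneg hS (EuclideanSpace.single i 1 + EuclideanSpace.single j 1)
  have h2 := quad_nonneg hS (EuclideanSpace.single i 1 - EuclideanSpace.single j 1)
  rw [quad_add_single hs] at h1
  rw [quad_sub_single hs] at h2
  rw [abs_le]
  constructor <;> linarith

theorem diag_le_trace {S : Mat d} (hS : S.PosSemidef) (i : Fin d) : S i i ≤ S.trace :=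
  Finset.single_le_sum (f := fun i => S i i) (fun _ _ => hS.diag_nonneg) (Finset.mem_univ i)

end Polarization

/-! ### Finiteness of the inverse Wishart mass, and its mean. -/

section Mass

variable {d : ℕ}

theorem measurable_outer : Measurable (outer (d := d)) := by
  rw [measurable_mat_iff]
  intro i j
  simp only [outer, vecMulVec_apply]
  fun_prop

theorem measurable_ofReal_iwKernel (m : ℝ) (M : Mat d) :
    Measurable fun S => ENNReal.ofReal (iwKernel m M S) :=
  (measurable_iwKernel m measurable_const measurable_id).ennreal_ofReal

/-- One Gaussian observation x with covariance S adds one degree of freedom and x xᵀ to the scale.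
This drives both the conjugacy of the model and the recursion in m. -/
theorem iwKernel_add_outer (m : ℝ) (M S : Mat d) (x : Vec d) :
    iwKernel (m + 1) (M + outer x) S =
      S.det ^ (-(1 / 2) : ℝ) * Real.exp (-(1 / 2) * quad S⁻¹ x) * iwKernel m M S := by
  by_cases h : S.PosDef
  · rw [iwKernel_of_posDef h, iwKernel_of_posDef h, Matrix.add_mul, trace_add, trace_outer_mul,
      mul_mul_mul_comm, ← Real.rpow_add h.det_pos, ← Real.exp_add]
    congr 2 <;> ring
  · rw [iwKernel_of_not_posDef h, iwKernel_of_not_posDef h, mul_zero]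

theorem lintegral_mul_iwMass_add_outer (m : ℝ) (M : Mat d) {F : Vec d → ℝ≥0∞} (hF : Measurable F) :
    ∫⁻ x, F x * iwMass (m + 1) (M + outer x) =
      ∫⁻ S, ENNReal.ofReal (S.det ^ (-(1 / 2) : ℝ)) *
        (∫⁻ x, F x * ENNReal.ofReal (Real.exp (-(1 / 2) * quad S⁻¹ x))) *
        ENNReal.ofReal (iwKernel m M S) ∂symVolume d := by
  have hm : Measurable fun p : Vec d × Mat d =>
      ENNReal.ofReal (iwKernel (m + 1) (M + outer p.1) p.2) :=
    (measurable_iwKernel _ ((measurable_outer.comp measurable_fst).const_add M)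
      measurable_snd).ennreal_ofReal
  have h1 : ∀ x, F x * iwMass (m + 1) (M + outer x) =
      ∫⁻ S, F x * ENNReal.ofReal (iwKernel (m + 1) (M + outer x) S) ∂symVolume d := fun x => by
    rw [iwMass, lintegral_const_mul _ (measurable_ofReal_iwKernel _ _)]
  simp only [h1]
  rw [lintegral_lintegral_swap ((hF.comp measurable_fst).mul hm).aemeasurable]
  refine lintegral_congr fun S => ?_
  have hq : Measurable fun x : Vec d => ENNReal.ofReal (Real.exp (-(1 / 2) * quad S⁻¹ x)) :=
    (((measurable_quad measurable_const measurable_id).const_mul _).exp).ennreal_ofReal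
  have hFq : Measurable fun x : Vec d =>
      F x * ENNReal.ofReal (Real.exp (-(1 / 2) * quad S⁻¹ x)) := hF.mul hq
  rw [mul_assoc, mul_comm (lintegral _ _), ← lintegral_const_mul _ hFq,
    ← lintegral_const_mul _ (hFq.const_mul _)]
  refine lintegral_congr fun x => ?_
  by_cases h : S.PosDef
  · have := h.det_pos
    rw [iwKernel_add_outer, ENNReal.ofReal_mul (by positivity), ENNReal.ofReal_mul (by positivity)]
    ring
  · rw [iwKernel_of_not_posDef h, iwKernel_of_not_posDef h]
    simp

theorem gauss_cancel {S : Mat d} (h : S.PosDef) :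
    ENNReal.ofReal (S.det ^ (-(1 / 2) : ℝ)) * ENNReal.ofReal (S.det ^ (1 / 2 : ℝ)) = 1 := by
  have := h.det_pos
  rw [← ENNReal.ofReal_mul (by positivity), ← Real.rpow_add this]
  simp

/-- The N(0, S) kernel in x, rescaled by det S^(−1/2), has mass `gaussMass d` for every S; apply
Tonelli to the pair (x, S). -/
theorem gaussMass_mul_iwMass (m : ℝ) (M : Mat d) :
    gaussMass d * iwMass m M = ∫⁻ x, iwMass (m + 1) (M + outer x) := by
  have h := lintegral_mul_iwMass_add_outer m M (F := fun _ => 1) measurable_const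
  simp only [one_mul] at h
  rw [h, iwMass, ← lintegral_const_mul _ (measurable_ofReal_iwKernel m M)]
  refine lintegral_congr fun S => ?_
  by_cases hS : S.PosDef
  · rw [lintegral_quad_inv hS (g := fun r => ENNReal.ofReal (Real.exp (-(1 / 2) * r)))
      (by fun_prop), ← mul_assoc, gauss_cancel hS, one_mul, gaussMass]
  · rw [iwKernel_of_not_posDef hS]
    simp

/-- The same double integral weighted by ⟨v, x⟩², whose mean under N(0, S) is vᵀSv. -/
theorem gaussMass_mul_lintegral_quad (hd : 1 ≤ d) (m : ℝ) (M : Mat d) (v : Vec d) :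
    gaussMass d * ∫⁻ S, ENNReal.ofReal (quad S v) * ENNReal.ofReal (iwKernel m M S) ∂symVolume d =
      ∫⁻ x, ENNReal.ofReal (inner ℝ v x ^ 2) * iwMass (m + 1) (M + outer x) := by
  have hd0 : (0 : ℝ) < d := by exact_mod_cast hd
  have hm : Measurable fun S : Mat d =>
      ENNReal.ofReal (quad S v) * ENNReal.ofReal (iwKernel m M S) :=
    (measurable_quad measurable_id measurable_const).ennreal_ofReal.mul
      (measurable_iwKernel m measurable_const measurable_id).ennreal_ofReal
  rw [lintegral_mul_iwMass_add_outer m M (by fun_prop), ← lintegral_const_mul _ hm]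
  refine lintegral_congr fun S => ?_
  by_cases hS : S.PosDef
  · rw [lintegral_inner_sq_quad_inv hd hS (g := fun r => ENNReal.ofReal (Real.exp (-(1 / 2) * r)))
      (by fun_prop), lintegral_norm_sq_gauss hd, ← mul_assoc (ENNReal.ofReal (_ ^ _)),
      gauss_cancel hS, one_mul, ← mul_assoc (ENNReal.ofReal _), ← ENNReal.ofReal_natCast d,
      ← ENNReal.ofReal_mul (div_nonneg (quad_nonneg hS.posSemidef v) hd0.le),
      div_mul_cancel₀ _ hd0.ne']
    ring
  · rw [iwKernel_of_not_posDef hS]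
    simp

theorem posDef_add_outer {M : Mat d} (hM : M.PosDef) (x : Vec d) : (M + outer x).PosDef :=
  hM.add_posSemidef (outer_posSemidef x)

theorem quad_inv_nonneg {M : Mat d} (hM : M.PosDef) (x : Vec d) : 0 ≤ quad M⁻¹ x :=
  quad_nonneg hM.inv.posSemidef x

theorem iwMass_add_outer (m : ℝ) {M : Mat d} (hM : M.PosDef) (x : Vec d) :
    iwMass m (M + outer x) = ENNReal.ofReal (M.det ^ (-m / 2)) * iwMass m (1 : Mat d) *
      ENNReal.ofReal ((1 + quad M⁻¹ x) ^ (-(m / 2))) := by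
  have h1 := hM.det_pos
  have h2 := quad_inv_nonneg hM x
  rw [iwMass_eq m (posDef_add_outer hM x), det_add_outer hM,
    Real.mul_rpow h1.le (by positivity), ENNReal.ofReal_mul (by positivity), neg_div]
  ring

theorem gaussMass_mul_iwMass_eq (m : ℝ) {M : Mat d} (hM : M.PosDef) :
    gaussMass d * iwMass m M = ENNReal.ofReal (M.det ^ (-(m + 1) / 2)) * iwMass (m + 1) (1 : Mat d) *
      (ENNReal.ofReal (M.det ^ (1 / 2 : ℝ)) * tMass d ((m + 1) / 2)) := by
  have hg : Measurable fun r : ℝ => ENNReal.ofReal ((1 + r) ^ (-((m + 1) / 2))) := by fun_prop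
  rw [gaussMass_mul_iwMass]
  simp only [iwMass_add_outer _ hM]
  have hgq : Measurable fun x : Vec d =>
      ENNReal.ofReal ((1 + quad M⁻¹ x) ^ (-((m + 1) / 2))) :=
    hg.comp (measurable_quad measurable_const measurable_id)
  rw [lintegral_const_mul _ hgq, lintegral_quad_inv hM hg, tMass]

/-- The masses at m and m + 1 differ by the t mass with exponent (m + 1)/2, which is finite because
m + 1 > d. -/
theorem iwMass_ne_top_of_succ {m : ℝ} (hm : (d : ℝ) - 1 < m)
    (h : iwMass (m + 1) (1 : Mat d) ≠ ∞) : iwMass m (1 : Mat d) ≠ ∞ := by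
  have e := gaussMass_mul_iwMass_eq m (PosDef.one (n := Fin d) (R := ℝ))
  have hfin : gaussMass d * iwMass m (1 : Mat d) ≠ ∞ := by
    rw [e]
    exact ENNReal.mul_ne_top (ENNReal.mul_ne_top ENNReal.ofReal_ne_top h)
      (ENNReal.mul_ne_top ENNReal.ofReal_ne_top (tMass_ne_top (by linarith)))
  intro h0
  rw [h0, ENNReal.mul_top gaussMass_ne_zero] at hfin
  exact hfin rfl

/-- Raise 1 + l⁻¹ ≤ 2p exp(l⁻¹/(2p)) to the power p; this follows from 1 + t ≤ exp t together with
2p ≥ 1. -/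
theorem rpow_mul_exp_le {p : ℝ} (hp : 1 ≤ 2 * p) {l : ℝ} (hl : 0 < l) :
    l ^ (-p) * Real.exp (-(1 / 2) * l⁻¹) ≤ (2 * p) ^ p * (1 + l) ^ (-p) := by
  have hp0 : 0 < p := by linarith
  have h1 : 1 + l⁻¹ ≤ 2 * p * Real.exp (l⁻¹ / (2 * p)) := by
    have := Real.add_one_le_exp (l⁻¹ / (2 * p))
    calc 1 + l⁻¹ ≤ 2 * p * (l⁻¹ / (2 * p) + 1) := by
          rw [mul_add, mul_div_cancel₀ _ (by positivity)]; linarith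
      _ ≤ _ := by gcongr
  have h2 : (1 + l⁻¹) ^ p ≤ (2 * p) ^ p * Real.exp (1 / 2 * l⁻¹) := by
    calc (1 + l⁻¹) ^ p ≤ (2 * p * Real.exp (l⁻¹ / (2 * p))) ^ p := by gcongr
      _ = _ := by
        rw [Real.mul_rpow (by positivity) (by positivity), ← Real.exp_mul]
        congr 2
        field_simp
  have h3 : (1 + l) = l * (1 + l⁻¹) := by field_simp; ring
  rw [h3, Real.mul_rpow hl.le (by positivity), Real.rpow_neg (by positivity : 0 ≤ 1 + l⁻¹),
    neg_mul, Real.exp_neg]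
  have h4 : (Real.exp (1 / 2 * l⁻¹))⁻¹ ≤ (2 * p) ^ p * ((1 + l⁻¹) ^ p)⁻¹ := by
    rw [inv_le_iff_one_le_mul₀ (Real.exp_pos _), mul_right_comm, ← div_eq_mul_inv,
      one_le_div (by positivity)]
    exact h2
  calc l ^ (-p) * (Real.exp (1 / 2 * l⁻¹))⁻¹ ≤ l ^ (-p) * ((2 * p) ^ p * ((1 + l⁻¹) ^ p)⁻¹) := by
        gcongr
    _ = _ := by ring

theorem one_add_sum_le_prod {ι : Type*} (s : Finset ι) {f : ι → ℝ} (hf : ∀ i, 0 ≤ f i) :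
    1 + ∑ i ∈ s, f i ≤ ∏ i ∈ s, (1 + f i) := by
  classical
  induction s using Finset.induction_on with
  | empty => simp
  | insert a s ha ih =>
    rw [Finset.sum_insert ha, Finset.prod_insert ha]
    have h1 : 0 ≤ ∑ i ∈ s, f i := Finset.sum_nonneg fun i _ => hf i
    have h2 := mul_le_mul_of_nonneg_left ih (add_nonneg zero_le_one (hf a))
    nlinarith [mul_nonneg (hf a) h1]

/-- For the identity scale the kernel is a product over eigenvalues. Each factor is bounded by
`rpow_mul_exp_le`, and ∏ (1 + s_i) ≥ 1 + tr S. -/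
theorem iwKernel_one_le {m : ℝ} (hm : 0 ≤ m) {S : Mat d} (hS : S.PosDef) :
    iwKernel m 1 S ≤ ((m + d + 1) ^ ((m + d + 1) / 2)) ^ d *
      (1 + S.trace) ^ (-((m + d + 1) / 2)) := by
  obtain ⟨U, s, hs, h1, h2, h⟩ := exists_spectral hS
  have hdet : S.det = ∏ i, s i := by
    rw [h, det_mul_right_comm, h1, Matrix.one_mul, det_diagonal]
  have htr : S.trace = ∑ i, s i := by
    rw [h, trace_mul_comm, ← Matrix.mul_assoc, h2, Matrix.one_mul, trace_diagonal]
  have hinv : S⁻¹ = U * diagonal (fun i => (s i)⁻¹) * Uᵀ := by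
    refine inv_eq_right_inv ?_
    rw [h, Matrix.mul_assoc, ← Matrix.mul_assoc Uᵀ, ← Matrix.mul_assoc Uᵀ, h2, Matrix.one_mul,
      Matrix.mul_assoc U, ← Matrix.mul_assoc (diagonal s), diagonal_mul_diagonal]
    have : (fun i => s i * (s i)⁻¹) = fun _ => (1 : ℝ) := funext fun i => mul_inv_cancel₀ (hs i).ne'
    rw [this, diagonal_one, Matrix.one_mul, h1]
  have htri : (1 * S⁻¹).trace = ∑ i, (s i)⁻¹ := by
    rw [Matrix.one_mul, hinv, trace_mul_comm, ← Matrix.mul_assoc, h2, Matrix.one_mul, trace_diagonal]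
  set p := (m + d + 1) / 2 with hpdef
  have hp : 1 ≤ 2 * p := by
    have : (0 : ℝ) ≤ d := Nat.cast_nonneg d
    rw [hpdef]; linarith
  have hp0 : 0 ≤ p := by linarith
  rw [iwKernel_of_posDef hS, hdet, htr, htri, neg_div, ← hpdef, Finset.mul_sum, Real.exp_sum,
    ← Real.finsetProd_rpow _ _ (fun i _ => (hs i).le), ← Finset.prod_mul_distrib]
  calc ∏ i, s i ^ (-p) * Real.exp (-(1 / 2) * (s i)⁻¹)
      ≤ ∏ i, ((2 * p) ^ p * (1 + s i) ^ (-p)) :=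
        Finset.prod_le_prod (fun i _ => by have := hs i; positivity)
          fun i _ => rpow_mul_exp_le hp (hs i)
    _ = ((2 * p) ^ p) ^ d * (∏ i, (1 + s i)) ^ (-p) := by
        rw [Finset.prod_mul_distrib, Finset.prod_const, Finset.card_univ, Fintype.card_fin,
          Real.finsetProd_rpow _ _ (fun i _ => by have := hs i; positivity)]
    _ ≤ _ := by
        have h3 : 2 * p = m + d + 1 := by rw [hpdef]; ring
        have hsum : 0 ≤ ∑ i, s i := Finset.sum_nonneg fun i _ => (hs i).le
        rw [← h3]
        refine mul_le_mul_of_nonneg_left ?_ (by positivity)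
        exact Real.rpow_le_rpow_of_nonpos (by positivity)
          (one_add_sum_le_prod _ fun i => (hs i).le) (by linarith)

/-- On positive definite matrices the sup norm of the coordinates is at most the trace, so the
kernel is dominated by a power of 1 + ‖x‖ that is integrable once it exceeds the dimension. -/
theorem iwMass_one_ne_top_of_large {m : ℝ} (hm : 0 ≤ m)
    (h : (Module.finrank ℝ (Sym2 (Fin d) → ℝ) : ℝ) < (m + d + 1) / 2) :
    iwMass m (1 : Mat d) ≠ ∞ := by
  have hd : (0 : ℝ) ≤ d := Nat.cast_nonneg d
  have hk : Measurable fun S : Mat d => ENNReal.ofReal (iwKernel m 1 S) :=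
    (measurable_iwKernel m measurable_const measurable_id).ennreal_ofReal
  have hfin := finite_integral_one_add_norm (E := Sym2 (Fin d) → ℝ) (μ := volume) h
  rw [iwMass, lintegral_symVolume hk]
  set C := ((m + d + 1) ^ ((m + d + 1) / 2)) ^ d
  have hC : 0 ≤ C := by positivity
  refine ne_top_of_le_ne_top (ENNReal.mul_ne_top (ENNReal.ofReal_ne_top (r := C)) hfin.ne) ?_
  rw [← lintegral_const_mul _ (by fun_prop)]
  refine lintegral_mono fun x => ?_
  rw [← ENNReal.ofReal_mul hC]
  refine ENNReal.ofReal_le_ofReal ?_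
  by_cases hS : (symMat x).PosDef
  · refine (iwKernel_one_le hm hS).trans (mul_le_mul_of_nonneg_left ?_ hC)
    have hn : ‖x‖ ≤ (symMat x).trace := by
      have h0 := hS.posSemidef.trace_nonneg
      rw [pi_norm_le_iff_of_nonneg h0]
      intro σ
      induction σ with | _ i j =>
      have h1 := abs_entry_le hS.posSemidef i j
      have h2 := diag_le_trace hS.posSemidef i
      have h3 := diag_le_trace hS.posSemidef j
      rw [symMat_apply] at h1
      rw [Real.norm_eq_abs]
      linarith
    exact Real.rpow_le_rpow_of_nonpos (by positivity) (by linarith) (by linarith)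
  · rw [iwKernel_of_not_posDef hS]
    positivity

theorem iwMass_one_ne_top {m : ℝ} (hm : (d : ℝ) - 1 < m) : iwMass m (1 : Mat d) ≠ ∞ := by
  -- N counts the unit steps from m up to the range where the crude bound works; finiteness is then
  -- carried back down.
  have key : ∀ N : ℕ, ∀ m : ℝ, (d : ℝ) - 1 < m →
      (Module.finrank ℝ (Sym2 (Fin d) → ℝ) : ℝ) < (m + N + d + 1) / 2 → 0 ≤ m + N →
      iwMass m (1 : Mat d) ≠ ∞ := by
    intro N
    induction N with
    | zero => exact fun m _ h h0 => iwMass_one_ne_top_of_large (by simpa using h0) (by simpa using h)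
    | succ N ih =>
      intro m hm h h0
      push_cast at h h0
      exact iwMass_ne_top_of_succ hm (ih (m + 1) (by linarith) (by linarith) (by linarith))
  obtain ⟨N, hN⟩ := exists_nat_gt (2 * (Module.finrank ℝ (Sym2 (Fin d) → ℝ) : ℝ) - m)
  have hd : (0 : ℝ) ≤ d := Nat.cast_nonneg d
  have hr : (0 : ℝ) ≤ Module.finrank ℝ (Sym2 (Fin d) → ℝ) := Nat.cast_nonneg _
  exact key N m hm (by linarith) (by linarith)

/-- The mean of the inverse Wishart distribution, in terms of quadratic forms. -/
theorem lintegral_quad_iwKernel (hd : 1 ≤ d) {m : ℝ} (hm : (d : ℝ) + 1 < m) {M : Mat d}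
    (hM : M.PosDef) (v : Vec d) :
    ∫⁻ S, ENNReal.ofReal (quad S v) * ENNReal.ofReal (iwKernel m M S) ∂symVolume d =
      ENNReal.ofReal (quad M v / (m - d - 1)) * iwMass m M := by
  have hd0 : (0 : ℝ) < d := by exact_mod_cast hd
  have hg : Measurable fun r : ℝ => ENNReal.ofReal ((1 + r) ^ (-((m + 1) / 2))) := by fun_prop
  -- Finiteness of the Gaussian mass is read off from the recursion, whose other side is finite.
  have hgt : gaussMass d ≠ ∞ := by
    intro h
    have e := gaussMass_mul_iwMass_eq m (PosDef.one (n := Fin d) (R := ℝ))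
    rw [h, ENNReal.top_mul (iwMass_one_ne_zero m)] at e
    exact ENNReal.mul_ne_top (ENNReal.mul_ne_top ENNReal.ofReal_ne_top
      (iwMass_one_ne_top (by linarith)))
      (ENNReal.mul_ne_top ENNReal.ofReal_ne_top (tMass_ne_top (by linarith))) e.symm
  rw [← ENNReal.mul_right_inj gaussMass_ne_zero hgt, gaussMass_mul_lintegral_quad hd]
  simp only [iwMass_add_outer _ hM]
  have e : ∀ x : Vec d, ENNReal.ofReal (inner ℝ v x ^ 2) *
      (ENNReal.ofReal (M.det ^ (-(m + 1) / 2)) * iwMass (m + 1) (1 : Mat d) *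
        ENNReal.ofReal ((1 + quad M⁻¹ x) ^ (-((m + 1) / 2)))) =
      (ENNReal.ofReal (M.det ^ (-(m + 1) / 2)) * iwMass (m + 1) (1 : Mat d)) *
      (ENNReal.ofReal (inner ℝ v x ^ 2) *
        ENNReal.ofReal ((1 + quad M⁻¹ x) ^ (-((m + 1) / 2)))) := fun x => by ring
  simp only [e]
  have hmeas : Measurable fun x : Vec d => ENNReal.ofReal (inner ℝ v x ^ 2) *
      ENNReal.ofReal ((1 + quad M⁻¹ x) ^ (-((m + 1) / 2))) :=
    Measurable.mul (by fun_prop) (hg.comp (measurable_quad measurable_const measurable_id))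
  rw [lintegral_const_mul _ hmeas, lintegral_inner_sq_quad_inv hd hM hg,
    lintegral_norm_sq_t hd (by linarith), mul_left_comm (gaussMass d), gaussMass_mul_iwMass_eq m hM,
    ← mul_assoc (ENNReal.ofReal (quad M v / d)),
    ← ENNReal.ofReal_mul (div_nonneg (quad_nonneg hM.posSemidef v) hd0.le)]
  have : quad M v / d * (d / (2 * ((m + 1) / 2) - 2 - d)) = quad M v / (m - d - 1) := by
    rw [div_mul_div_cancel₀ hd0.ne']
    congr 1
    ring
  rw [this]
  ring

end Mass

/-! ### Weighted mean and posterior scale matrix. -/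

section Sufficient

variable {d : ℕ}

/-- The precision factor `n_j + 1/2` of the `j`-th observation. -/
noncomputable def prec (n : ℕ → ℕ) (j : ℕ) : ℝ := (n j : ℝ) + 1 / 2

theorem prec_pos (n : ℕ → ℕ) (j : ℕ) : 0 < prec n j := by unfold prec; positivity

/-- The total precision factor of the first `K` observations. -/
noncomputable def totalPrec (n : ℕ → ℕ) (K : ℕ) : ℝ := ∑ j ∈ Finset.range K, prec n j

theorem half_le_totalPrec (n : ℕ → ℕ) (K : ℕ) : (K : ℝ) / 2 ≤ totalPrec n K := by
  have : ∑ j ∈ Finset.range K, (1 / 2 : ℝ) ≤ totalPrec n K :=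
    Finset.sum_le_sum fun j _ => by unfold prec; linarith [(Nat.cast_nonneg (n j) : (0 : ℝ) ≤ n j)]
  simpa [div_eq_mul_inv] using this

theorem totalPrec_pos (n : ℕ → ℕ) {K : ℕ} (hK : 1 ≤ K) : 0 < totalPrec n K := by
  have h := half_le_totalPrec n K
  have : (1 : ℝ) ≤ K := by exact_mod_cast hK
  linarith

/-- The weighted sample mean. -/
noncomputable def wmean (n : ℕ → ℕ) (K : ℕ) (x : ℕ → Vec d) : Vec d :=
  (totalPrec n K)⁻¹ • ∑ j ∈ Finset.range K, prec n j • x j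

/-- The posterior scale matrix of `Σ` given `μ`. -/
noncomputable def scaleMat (Ψ : Mat d) (n : ℕ → ℕ) (K : ℕ) (x : ℕ → Vec d) (μ : Vec d) : Mat d :=
  Ψ + ∑ j ∈ Finset.range K, prec n j • outer (x j - μ)

theorem outer_smul (c : ℝ) (x : Vec d) : outer (c • x) = c ^ 2 • outer x := by
  ext i j
  simp [outer, vecMulVec_apply]
  ring

theorem scaleMat_posDef {Ψ : Mat d} (hΨ : Ψ.PosDef) (n : ℕ → ℕ) (K : ℕ) (x : ℕ → Vec d)
    (μ : Vec d) : (scaleMat Ψ n K x μ).PosDef :=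
  hΨ.add_posSemidef (posSemidef_sum _ fun j _ => (outer_posSemidef _).smul (prec_pos n j).le)

/-- Bilinear parallel-axis identity, stated for two sequences so that it applies to each matrix
entry. -/
theorem sum_mul_sub_mul_sub (s : Finset ℕ) (w a b : ℕ → ℝ) {W p q : ℝ} (hW : ∑ j ∈ s, w j = W)
    (hp : ∑ j ∈ s, w j * a j = W * p) (hq : ∑ j ∈ s, w j * b j = W * q) (u v : ℝ) :
    ∑ j ∈ s, w j * ((a j - u) * (b j - v)) =
      ∑ j ∈ s, w j * ((a j - p) * (b j - q)) + W * ((u - p) * (v - q)) := by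
  have key : ∀ u v : ℝ, ∑ j ∈ s, w j * ((a j - u) * (b j - v)) =
      ∑ j ∈ s, w j * (a j * b j) - W * p * v - W * q * u + W * (u * v) := by
    intro u v
    rw [← hp, ← hq, ← hW, Finset.sum_mul, Finset.sum_mul, Finset.sum_mul, ← Finset.sum_sub_distrib,
      ← Finset.sum_sub_distrib, ← Finset.sum_add_distrib]
    exact Finset.sum_congr rfl fun j _ => by ring
  rw [key u v, key p q]
  ring

theorem sum_prec_mul (n : ℕ → ℕ) {K : ℕ} (hK : 1 ≤ K) (x : ℕ → Vec d) (i : Fin d) :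
    ∑ j ∈ Finset.range K, prec n j * x j i = totalPrec n K * wmean n K x i := by
  simp [wmean, (totalPrec_pos n hK).ne']

theorem scaleMat_eq (Ψ : Mat d) (n : ℕ → ℕ) {K : ℕ} (hK : 1 ≤ K) (x : ℕ → Vec d) (μ : Vec d) :
    scaleMat Ψ n K x μ = scaleMat Ψ n K x (wmean n K x) +
      outer (√(totalPrec n K) • (μ - wmean n K x)) := by
  rw [outer_smul, Real.sq_sqrt (totalPrec_pos n hK).le]
  ext i k
  have h := sum_mul_sub_mul_sub (Finset.range K) (prec n) (fun j => x j i) (fun j => x j k) rfl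
    (sum_prec_mul n hK x i) (sum_prec_mul n hK x k) (μ i) (μ k)
  simp only [scaleMat, Matrix.add_apply, Matrix.sum_apply, Matrix.smul_apply, outer,
    vecMulVec_apply, smul_eq_mul, PiLp.sub_apply]
  rw [h]
  simp only [totalPrec]
  ring

end Sufficient

/-! ### Conjugacy of the likelihood and of the prior on μ. -/

section Factorization

variable {d : ℕ}

theorem gaussianDensity_eq (m : Vec d) (S : Mat d) (x : Vec d) :
    gaussianDensity m S x = (2 * Real.pi) ^ (-(d : ℝ) / 2) * S.det ^ (-(1 / 2) : ℝ)
      * Real.exp (-(1 / 2) * quad S⁻¹ (x - m)) := rfl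

theorem measurable_gaussianDensity {β : Type*} [MeasurableSpace β] {m x : β → Vec d} {S : β → Mat d}
    (hm : Measurable m) (hS : Measurable S) (hx : Measurable x) :
    Measurable fun b => gaussianDensity (m b) (S b) (x b) := by
  simp only [gaussianDensity_eq]
  exact (((measurable_det.comp hS).pow_const _).const_mul _).mul
    ((measurable_quad (measurable_inv.comp hS) (hx.sub hm)).const_mul _).exp

theorem gaussianDensity_mul_iwKernel (m ν : ℝ) (μ α : Vec d) (M S : Mat d) (hm : m + 1 = ν) :
    gaussianDensity α S μ * iwKernel m M S =
      (2 * Real.pi) ^ (-(d : ℝ) / 2) * iwKernel ν (M + outer (μ - α)) S := by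
  rw [gaussianDensity_eq, ← hm, iwKernel_add_outer]
  ring

theorem quad_smul_right (S : Mat d) (c : ℝ) (v : Vec d) : quad S (c • v) = c ^ 2 * quad S v := by
  simp [quad, mulVec_smul]
  ring

theorem gaussianDensity_inv_smul {w : ℝ} (hw : 0 < w) {S : Mat d} (hS : S.PosDef) (μ x : Vec d) :
    gaussianDensity μ (w⁻¹ • S) x = (w⁻¹ ^ d) ^ (-(1 / 2) : ℝ) *
      ((2 * Real.pi) ^ (-(d : ℝ) / 2) * S.det ^ (-(1 / 2) : ℝ) *
        Real.exp (-(1 / 2) * quad S⁻¹ (√w • (x - μ)))) := by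
  have hinv : (w⁻¹ • S)⁻¹ = w • S⁻¹ := by
    refine inv_eq_right_inv ?_
    rw [Matrix.smul_mul, Matrix.mul_smul, smul_smul, inv_mul_cancel₀ hw.ne', one_smul,
      mul_nonsing_inv _ ((isUnit_iff_isUnit_det S).1 hS.isUnit)]
  rw [gaussianDensity_eq, hinv, det_smul, Fintype.card_fin, quad_smul, quad_smul_right,
    Real.sq_sqrt hw.le, Real.mul_rpow (by positivity) hS.det_pos.le]
  ring

variable (d) in
/-- The constant factor of the likelihood. -/
noncomputable def likConst (n : ℕ → ℕ) (K : ℕ) : ℝ :=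
  ∏ j ∈ Finset.range K, (((prec n j)⁻¹ ^ d) ^ (-(1 / 2) : ℝ) * (2 * Real.pi) ^ (-(d : ℝ) / 2))

theorem likConst_pos (n : ℕ → ℕ) (K : ℕ) : 0 < likConst d n K :=
  Finset.prod_pos fun j _ => by have := prec_pos n j; positivity

/-- Each observation acts through `iwKernel_add_outer` with the vector √w_j (x_j − μ); the leftover
powers of w_j and 2π do not depend on the parameters. -/
theorem likelihood_mul_iwKernel (Ψ : Mat d) (ν : ℝ) (n : ℕ → ℕ) (K : ℕ) (x : ℕ → Vec d)
    (μ : Vec d) (S T : Mat d) :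
    likelihood n K x (μ, S, T) * iwKernel ν Ψ S =
      likConst d n K * iwKernel (ν + K) (scaleMat Ψ n K x μ) S := by
  by_cases hS : S.PosDef
  swap
  · rw [iwKernel_of_not_posDef hS, iwKernel_of_not_posDef hS, mul_zero, mul_zero]
  induction K with
  | zero => simp [likelihood, likConst, scaleMat]
  | succ K ih =>
    have hw := prec_pos n K
    have h1 : likelihood n (K + 1) x (μ, S, T) = likelihood n K x (μ, S, T) *
        gaussianDensity μ ((prec n K)⁻¹ • S) (x K) := by
      rw [likelihood, Finset.prod_range_succ]; rfl
    have h2 : scaleMat Ψ n (K + 1) x μ = scaleMat Ψ n K x μ + outer (√(prec n K) • (x K - μ)) := by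
      rw [scaleMat, Finset.sum_range_succ, ← add_assoc, outer_smul, Real.sq_sqrt hw.le]; rfl
    have h3 : likConst d n (K + 1) = likConst d n K *
        (((prec n K)⁻¹ ^ d) ^ (-(1 / 2) : ℝ) * (2 * Real.pi) ^ (-(d : ℝ) / 2)) := by
      rw [likConst, Finset.prod_range_succ]; rfl
    rw [h1, h2, h3, Nat.cast_succ, ← add_assoc, iwKernel_add_outer, mul_right_comm, ih,
      gaussianDensity_inv_smul hw hS]
    ring

/-- The normalising constant in `invWishartDensity`. -/
noncomputable def iwConst (Ψ : Mat d) (ν : ℝ) : ℝ :=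
  Ψ.det ^ (ν / 2) / ((2 : ℝ) ^ (ν * d / 2) * multivariateGamma d (ν / 2))

/-- Positivity is all that is needed: the value of the constant cancels in Bayes' formula. -/
theorem iwConst_pos {Ψ : Mat d} (hΨ : Ψ.PosDef) {ν : ℝ} (hν : (d : ℝ) - 1 < ν) :
    0 < iwConst Ψ ν := by
  have h1 := hΨ.det_pos
  have h2 : 0 < multivariateGamma d (ν / 2) := by
    refine mul_pos (by positivity) (Finset.prod_pos fun i _ => Real.Gamma_pos_of_pos ?_)
    have : ((i : ℕ) : ℝ) + 1 ≤ d := by exact_mod_cast i.2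
    linarith
  unfold iwConst
  positivity

theorem invWishartDensity_eq (Ψ : Mat d) (ν : ℝ) (S : Mat d) :
    invWishartDensity Ψ ν S = iwConst Ψ ν * iwKernel ν Ψ S := by
  by_cases hS : S.PosDef
  · rw [iwKernel_of_posDef hS, invWishartDensity, if_pos hS, iwConst, mul_assoc]
  · rw [iwKernel_of_not_posDef hS, invWishartDensity, if_neg hS, mul_zero]

theorem measurable_ofReal_invWishartDensity (Ψ : Mat d) (ν : ℝ) :
    Measurable fun S => ENNReal.ofReal (invWishartDensity Ψ ν S) := by
  simp only [invWishartDensity_eq]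
  exact ((measurable_iwKernel ν measurable_const measurable_id).const_mul _).ennreal_ofReal

instance instSFiniteInvWishart (Ψ : Mat d) (ν : ℝ) : SFinite (invWishart Ψ ν) := by
  unfold invWishart; infer_instance

theorem lintegral_invWishart {Ψ : Mat d} (hΨ : Ψ.PosDef) {ν : ℝ} (hν : (d : ℝ) - 1 < ν)
    {F : Mat d → ℝ≥0∞} (hF : Measurable F) :
    ∫⁻ S, F S ∂invWishart Ψ ν = ENNReal.ofReal (iwConst Ψ ν) *
      ∫⁻ S, F S * ENNReal.ofReal (iwKernel ν Ψ S) ∂symVolume d := by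
  have hm : Measurable fun S => F S * ENNReal.ofReal (iwKernel ν Ψ S) :=
    hF.mul (measurable_ofReal_iwKernel ν Ψ)
  rw [invWishart, lintegral_withDensity_eq_lintegral_mul _
    (measurable_ofReal_invWishartDensity Ψ ν) hF, ← lintegral_const_mul _ hm]
  refine lintegral_congr fun S => ?_
  rw [Pi.mul_apply, invWishartDensity_eq, ENNReal.ofReal_mul (iwConst_pos hΨ hν).le]
  ring

theorem measurable_likelihood (n : ℕ → ℕ) (K : ℕ) (x : ℕ → Vec d) :
    Measurable (likelihood n K x) := by
  unfold likelihood
  refine Finset.measurable_fun_prod _ fun j _ =>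
    measurable_gaussianDensity measurable_fst ?_ measurable_const
  refine measurable_mat_iff.2 fun i k => ?_
  exact ((measurable_entry i k).comp (measurable_fst.comp measurable_snd)).const_mul _

/-- The marginal prior density of `μ`, up to a constant. -/
noncomputable def priorMu (α : Vec d) (Ψp : Mat d) (νp : ℝ) (μ : Vec d) : ℝ :=
  (1 + quad Ψp⁻¹ (μ - α)) ^ (-((νp + 1) / 2))

theorem measurable_priorMu (α : Vec d) (Ψp : Mat d) (νp : ℝ) : Measurable (priorMu α Ψp νp) :=
  ((measurable_quad measurable_const (measurable_id.sub_const α)).const_add 1).pow_const _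

theorem measurable_ofReal_gaussianDensity (α μ : Vec d) :
    Measurable fun T => ENNReal.ofReal (gaussianDensity α T μ) :=
  (measurable_gaussianDensity measurable_const measurable_id measurable_const).ennreal_ofReal

/-- Here μ plays the role of one observation with covariance Σ_p, so integrating Σ_p out gives the t
density. -/
theorem exists_lintegral_gaussianDensity {Ψp : Mat d} (hΨp : Ψp.PosDef) {νp : ℝ}
    (hνp : (d : ℝ) - 1 < νp) (α : Vec d) :
    ∃ c : ℝ≥0∞, c ≠ 0 ∧ c ≠ ∞ ∧ ∀ μ : Vec d,
      ∫⁻ T, ENNReal.ofReal (gaussianDensity α T μ) ∂invWishart Ψp νp =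
        c * ENNReal.ofReal (priorMu α Ψp νp μ) := by
  have hpi : 0 < (2 * Real.pi) ^ (-(d : ℝ) / 2) := by positivity
  have hdet := hΨp.det_pos
  refine ⟨ENNReal.ofReal (iwConst Ψp νp) * (ENNReal.ofReal ((2 * Real.pi) ^ (-(d : ℝ) / 2)) *
    (ENNReal.ofReal (Ψp.det ^ (-(νp + 1) / 2)) * iwMass (νp + 1) (1 : Mat d))), ?_, ?_, fun μ => ?_⟩
  · refine mul_ne_zero ?_ (mul_ne_zero ?_ (mul_ne_zero ?_ (iwMass_one_ne_zero _)))
    · simpa using iwConst_pos hΨp hνp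
    · simpa using hpi
    · simp only [ne_eq, ENNReal.ofReal_eq_zero, not_le]; positivity
  · exact ENNReal.mul_ne_top ENNReal.ofReal_ne_top (ENNReal.mul_ne_top ENNReal.ofReal_ne_top
      (ENNReal.mul_ne_top ENNReal.ofReal_ne_top (iwMass_one_ne_top (by linarith))))
  · rw [lintegral_invWishart hΨp hνp (measurable_ofReal_gaussianDensity α μ)]
    have h : ∀ T : Mat d, ENNReal.ofReal (gaussianDensity α T μ) *
        ENNReal.ofReal (iwKernel νp Ψp T) = ENNReal.ofReal ((2 * Real.pi) ^ (-(d : ℝ) / 2)) *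
          ENNReal.ofReal (iwKernel (νp + 1) (Ψp + outer (μ - α)) T) := fun T => by
      rw [← ENNReal.ofReal_mul' (iwKernel_nonneg _ _ _), gaussianDensity_mul_iwKernel _ _ _ _ _ _ rfl,
        ENNReal.ofReal_mul hpi.le]
    simp only [h]
    rw [lintegral_const_mul _ (measurable_ofReal_iwKernel _ _), ← iwMass, iwMass_add_outer _ hΨp,
      priorMu]
    ring

end Factorization

/-! ### Posterior expectations of functions of (μ, Σ). -/

section Posterior

variable {d : ℕ}

/-- The unnormalised posterior expectation of a function of `(μ, Σ)`. -/
noncomputable def postNum (α : Vec d) (Ψ : Mat d) (ν : ℝ) (Ψp : Mat d) (νp : ℝ) (n : ℕ → ℕ) (K : ℕ)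
    (x : ℕ → Vec d) (F : Vec d × Mat d → ℝ≥0∞) : ℝ≥0∞ :=
  ∫⁻ μ, ENNReal.ofReal (priorMu α Ψp νp μ) *
    ∫⁻ S, F (μ, S) * ENNReal.ofReal (iwKernel (ν + K) (scaleMat Ψ n K x μ) S) ∂symVolume d

theorem measurable_scaleMat (Ψ : Mat d) (n : ℕ → ℕ) (K : ℕ) (x : ℕ → Vec d) :
    Measurable (scaleMat Ψ n K x) := by
  rw [measurable_mat_iff]
  intro i j
  simp only [scaleMat, Matrix.add_apply, Matrix.sum_apply, Matrix.smul_apply, outer,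
    vecMulVec_apply, smul_eq_mul, PiLp.sub_apply]
  fun_prop

theorem lintegral_prior (α : Vec d) (Ψ : Mat d) (ν : ℝ) (Ψp : Mat d) (νp : ℝ)
    {F : Param d → ℝ≥0∞} (hF : Measurable F) :
    ∫⁻ θ, F θ ∂prior α Ψ ν Ψp νp = ∫⁻ μ, ∫⁻ S, ∫⁻ T,
      ENNReal.ofReal (gaussianDensity α T μ) * F (μ, S, T) ∂invWishart Ψp νp ∂invWishart Ψ ν := by
  have hg : Measurable fun θ : Param d => ENNReal.ofReal (gaussianDensity α θ.2.2 θ.1) :=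
    (measurable_gaussianDensity measurable_const (measurable_snd.comp measurable_snd)
      measurable_fst).ennreal_ofReal
  have hm : Measurable fun θ : Param d =>
      ENNReal.ofReal (gaussianDensity α θ.2.2 θ.1) * F θ := hg.mul hF
  rw [prior, lintegral_withDensity_eq_lintegral_mul _ hg hF]
  refine (lintegral_prod _ hm.aemeasurable).trans (lintegral_congr fun μ => ?_)
  exact lintegral_prod _ (hm.comp (measurable_prodMk_left (x := μ))).aemeasurable

theorem exists_lintegral_prior {Ψ Ψp : Mat d} (hΨ : Ψ.PosDef) (hΨp : Ψp.PosDef) {ν νp : ℝ}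
    (hν : (d : ℝ) - 1 < ν) (hνp : (d : ℝ) - 1 < νp) (α : Vec d) (n : ℕ → ℕ) (K : ℕ)
    (x : ℕ → Vec d) :
    ∃ c : ℝ≥0∞, c ≠ 0 ∧ c ≠ ∞ ∧ ∀ F : Vec d × Mat d → ℝ≥0∞, Measurable F →
      ∫⁻ θ, ENNReal.ofReal (likelihood n K x θ) * F (θ.1, θ.2.1) ∂prior α Ψ ν Ψp νp =
        c * postNum α Ψ ν Ψp νp n K x F := by
  obtain ⟨c, hc0, hct, hc⟩ := exists_lintegral_gaussianDensity hΨp hνp α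
  have hi := iwConst_pos hΨ hν
  have hl := likConst_pos (d := d) n K
  refine ⟨c * (ENNReal.ofReal (iwConst Ψ ν) * ENNReal.ofReal (likConst d n K)), ?_, ?_,
    fun F hF => ?_⟩
  · refine mul_ne_zero hc0 (mul_ne_zero ?_ ?_) <;> simpa
  · exact ENNReal.mul_ne_top hct (ENNReal.mul_ne_top ENNReal.ofReal_ne_top ENNReal.ofReal_ne_top)
  have hL : Measurable fun θ : Param d => ENNReal.ofReal (likelihood n K x θ) :=
    (measurable_likelihood n K x).ennreal_ofReal
  have hF' : Measurable fun θ : Param d => F (θ.1, θ.2.1) :=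
    hF.comp (measurable_fst.prodMk (measurable_fst.comp measurable_snd))
  have hLF : Measurable fun θ : Param d => ENNReal.ofReal (likelihood n K x θ) * F (θ.1, θ.2.1) :=
    hL.mul hF'
  rw [lintegral_prior α Ψ ν Ψp νp hLF, postNum, ← lintegral_const_mul']
  swap
  · exact ENNReal.mul_ne_top hct (ENNReal.mul_ne_top ENNReal.ofReal_ne_top ENNReal.ofReal_ne_top)
  refine lintegral_congr fun μ => ?_
  have hinner : ∀ S : Mat d, ∫⁻ T, ENNReal.ofReal (gaussianDensity α T μ) *
      (ENNReal.ofReal (likelihood n K x (μ, S, T)) * F (μ, S)) ∂invWishart Ψp νp =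
      c * ENNReal.ofReal (priorMu α Ψp νp μ) *
        (ENNReal.ofReal (likelihood n K x (μ, S, 0)) * F (μ, S)) := fun S => by
    rw [← hc μ, ← lintegral_mul_const _ (measurable_ofReal_gaussianDensity α μ)]
    rfl
  simp only [hinner]
  have hS : Measurable fun S : Mat d =>
      ENNReal.ofReal (likelihood n K x (μ, S, 0)) * F (μ, S) :=
    hLF.comp (f := fun S : Mat d => ((μ, S, 0) : Param d)) (by fun_prop)
  rw [lintegral_const_mul _ hS, lintegral_invWishart hΨ hν hS]
  have hk : ∀ S : Mat d, ENNReal.ofReal (likelihood n K x (μ, S, 0)) * F (μ, S) *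
      ENNReal.ofReal (iwKernel ν Ψ S) = ENNReal.ofReal (likConst d n K) *
      (F (μ, S) * ENNReal.ofReal (iwKernel (ν + K) (scaleMat Ψ n K x μ) S)) := fun S => by
    rw [mul_right_comm, ← ENNReal.ofReal_mul' (iwKernel_nonneg _ _ _), likelihood_mul_iwKernel,
      ENNReal.ofReal_mul hl.le]
    ring
  simp only [hk]
  have hm : Measurable fun S : Mat d =>
      F (μ, S) * ENNReal.ofReal (iwKernel (ν + K) (scaleMat Ψ n K x μ) S) :=
    (hF.comp measurable_prodMk_left).mul (measurable_ofReal_iwKernel _ _)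
  rw [lintegral_const_mul _ hm]
  ring

theorem lintegral_posterior {Ψ Ψp : Mat d} (hΨ : Ψ.PosDef) (hΨp : Ψp.PosDef) {ν νp : ℝ}
    (hν : (d : ℝ) - 1 < ν) (hνp : (d : ℝ) - 1 < νp) (α : Vec d) (n : ℕ → ℕ) (K : ℕ)
    (x : ℕ → Vec d) {F : Vec d × Mat d → ℝ≥0∞} (hF : Measurable F) :
    ∫⁻ θ, F (θ.1, θ.2.1) ∂posterior (prior α Ψ ν Ψp νp) n K x =
      (postNum α Ψ ν Ψp νp n K x fun _ => 1)⁻¹ * postNum α Ψ ν Ψp νp n K x F := by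
  obtain ⟨c, hc0, hct, hc⟩ := exists_lintegral_prior hΨ hΨp hν hνp α n K x
  have hF' : Measurable fun θ : Param d => F (θ.1, θ.2.1) :=
    hF.comp (measurable_fst.prodMk (measurable_fst.comp measurable_snd))
  have h1 := hc (fun _ => 1) measurable_const
  simp only [mul_one] at h1
  rw [posterior, bayes, lintegral_smul_measure, lintegral_withDensity_eq_lintegral_mul _
    (measurable_likelihood n K x).ennreal_ofReal hF', h1]
  simp only [Pi.mul_apply]
  rw [hc F hF, ENNReal.mul_inv (Or.inl hc0) (Or.inl hct), smul_eq_mul, mul_mul_mul_comm,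
    ENNReal.inv_mul_cancel hc0 hct, one_mul]

end Posterior

/-! ### Concentration of the marginal posterior of μ around the weighted mean. -/

section Estimates

variable {d : ℕ}

/-- The scale matrix at the weighted sample mean. -/
noncomputable def scatter (Ψ : Mat d) (n : ℕ → ℕ) (K : ℕ) (x : ℕ → Vec d) : Mat d :=
  scaleMat Ψ n K x (wmean n K x)

theorem scatter_posDef {Ψ : Mat d} (hΨ : Ψ.PosDef) (n : ℕ → ℕ) (K : ℕ) (x : ℕ → Vec d) :
    (scatter Ψ n K x).PosDef := scaleMat_posDef hΨ n K x _

/-- The normalised squared distance of `μ` from the weighted sample mean. -/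
noncomputable def mahal (Ψ : Mat d) (n : ℕ → ℕ) (K : ℕ) (x : ℕ → Vec d) (μ : Vec d) : ℝ :=
  quad (scatter Ψ n K x)⁻¹ (√(totalPrec n K) • (μ - wmean n K x))

theorem measurable_mahal (Ψ : Mat d) (n : ℕ → ℕ) (K : ℕ) (x : ℕ → Vec d) :
    Measurable (mahal Ψ n K x) :=
  measurable_quad measurable_const (by fun_prop)

theorem mahal_nonneg {Ψ : Mat d} (hΨ : Ψ.PosDef) (n : ℕ → ℕ) (K : ℕ) (x : ℕ → Vec d) (μ : Vec d) :
    0 ≤ mahal Ψ n K x μ := quad_inv_nonneg (scatter_posDef hΨ n K x) _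

theorem totalPrec_mul_inner_sq_le {Ψ : Mat d} (hΨ : Ψ.PosDef) (n : ℕ → ℕ) {K : ℕ} (hK : 1 ≤ K)
    (x : ℕ → Vec d) (v μ : Vec d) :
    totalPrec n K * inner ℝ v (μ - wmean n K x) ^ 2 ≤
      quad (scatter Ψ n K x) v * mahal Ψ n K x μ := by
  have h := inner_sq_le_quad_mul (scatter_posDef hΨ n K x) v
    (√(totalPrec n K) • (μ - wmean n K x))
  rwa [inner_smul_right, mul_pow, Real.sq_sqrt (totalPrec_pos n hK).le] at h

theorem norm_sub_wmean_sq_le {Ψ : Mat d} (hΨ : Ψ.PosDef) (n : ℕ → ℕ) {K : ℕ} (hK : 1 ≤ K)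
    (x : ℕ → Vec d) (μ : Vec d) :
    ‖μ - wmean n K x‖ ^ 2 ≤ (scatter Ψ n K x).trace / totalPrec n K * mahal Ψ n K x μ := by
  have hW := totalPrec_pos n hK
  rw [div_mul_eq_mul_div, le_div_iff₀ hW, EuclideanSpace.real_norm_sq_eq, Finset.sum_mul, trace,
    Finset.sum_mul]
  refine Finset.sum_le_sum fun i _ => ?_
  have h := totalPrec_mul_inner_sq_le hΨ n hK x (EuclideanSpace.single i 1) μ
  rw [quad_single, EuclideanSpace.inner_single_left] at h
  rw [mul_comm]
  simpa using h

/-- A lower bound for `priorMu` on a ball of radius `R` around the prior mean. -/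
noncomputable def priorLower (Ψp : Mat d) (νp R : ℝ) : ℝ :=
  (1 + (∑ i, ∑ j, |Ψp⁻¹ i j|) * R ^ 2) ^ (-((νp + 1) / 2))

theorem priorLower_pos (Ψp : Mat d) (νp R : ℝ) : 0 < priorLower Ψp νp R := by
  unfold priorLower; positivity

theorem priorLower_anti {Ψp : Mat d} {νp : ℝ} (hνp : 0 ≤ νp + 1) {r R : ℝ} (hr : 0 ≤ r)
    (h : r ≤ R) : priorLower Ψp νp R ≤ priorLower Ψp νp r := by
  unfold priorLower
  refine Real.rpow_le_rpow_of_nonpos (by positivity) (by gcongr) (by linarith)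

theorem priorLower_le {Ψp : Mat d} (hΨp : Ψp.PosDef) {νp : ℝ} (hνp : 0 ≤ νp + 1) {α μ : Vec d}
    {R : ℝ} (h : ‖μ - α‖ ≤ R) : priorLower Ψp νp R ≤ priorMu α Ψp νp μ := by
  have h1 := quad_inv_nonneg hΨp (μ - α)
  have h2 := (le_abs_self _).trans (abs_quad_le Ψp⁻¹ (μ - α))
  refine (priorLower_anti hνp (norm_nonneg _) h).trans ?_
  unfold priorLower priorMu
  exact Real.rpow_le_rpow_of_nonpos (by positivity) (by linarith) (by linarith)

theorem priorMu_le_one {Ψp : Mat d} (hΨp : Ψp.PosDef) {νp : ℝ} (hνp : 0 ≤ νp + 1) (α μ : Vec d) :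
    priorMu α Ψp νp μ ≤ 1 := by
  have h1 := quad_inv_nonneg hΨp (μ - α)
  exact Real.rpow_le_one_of_one_le_of_nonpos (by linarith) (by linarith)

/-- The unnormalised marginal posterior density of `μ`. -/
noncomputable def muWeight (α : Vec d) (Ψ : Mat d) (ν : ℝ) (Ψp : Mat d) (νp : ℝ) (n : ℕ → ℕ) (K : ℕ)
    (x : ℕ → Vec d) (μ : Vec d) : ℝ≥0∞ :=
  ENNReal.ofReal (priorMu α Ψp νp μ) * ENNReal.ofReal ((1 + mahal Ψ n K x μ) ^ (-((ν + K) / 2)))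

theorem measurable_muWeight (α : Vec d) (Ψ : Mat d) (ν : ℝ) (Ψp : Mat d) (νp : ℝ) (n : ℕ → ℕ)
    (K : ℕ) (x : ℕ → Vec d) : Measurable (muWeight α Ψ ν Ψp νp n K x) :=
  (measurable_priorMu α Ψp νp).ennreal_ofReal.mul
    (((measurable_mahal Ψ n K x).const_add 1).pow_const _).ennreal_ofReal

theorem postNum_fst {Ψ : Mat d} (hΨ : Ψ.PosDef) (α : Vec d) (ν : ℝ) (Ψp : Mat d) (νp : ℝ)
    (n : ℕ → ℕ) {K : ℕ} (hK : 1 ≤ K) (x : ℕ → Vec d) {F : Vec d → ℝ≥0∞} (hF : Measurable F) :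
    postNum α Ψ ν Ψp νp n K x (fun p => F p.1) =
      ENNReal.ofReal ((scatter Ψ n K x).det ^ (-(ν + K) / 2)) * iwMass (ν + K) (1 : Mat d) *
        ∫⁻ μ, F μ * muWeight α Ψ ν Ψp νp n K x μ := by
  have hm : Measurable fun μ => F μ * muWeight α Ψ ν Ψp νp n K x μ :=
    hF.mul (measurable_muWeight α Ψ ν Ψp νp n K x)
  rw [postNum, ← lintegral_const_mul _ hm]
  refine lintegral_congr fun μ => ?_
  dsimp only
  rw [lintegral_const_mul _ (measurable_ofReal_iwKernel _ _), ← iwMass, scaleMat_eq Ψ n hK,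
    iwMass_add_outer _ (scaleMat_posDef hΨ n K x _), muWeight, mahal, scatter]
  ring

/-- Tower property: Σ is replaced by its conditional mean given μ. -/
theorem postNum_quad (hd : 1 ≤ d) {Ψ : Mat d} (hΨ : Ψ.PosDef) (α : Vec d) {ν : ℝ} (Ψp : Mat d)
    (νp : ℝ) (n : ℕ → ℕ) {K : ℕ} (hm : (d : ℝ) + 1 < ν + K) (x : ℕ → Vec d) (v : Vec d) :
    postNum α Ψ ν Ψp νp n K x (fun p => ENNReal.ofReal (quad p.2 v)) =
      postNum α Ψ ν Ψp νp n K x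
        (fun p => ENNReal.ofReal (quad (scaleMat Ψ n K x p.1) v / (ν + K - d - 1))) := by
  rw [postNum, postNum]
  refine lintegral_congr fun μ => ?_
  dsimp only
  rw [lintegral_const_mul _ (measurable_ofReal_iwKernel _ _), ← iwMass,
    lintegral_quad_iwKernel hd hm (scaleMat_posDef hΨ n K x μ)]

/-- An affine change of variables makes `mahal` radial. The constant is the same for every g, so it
cancels between moment and mass. -/
theorem exists_lintegral_mahal {Ψ : Mat d} (hΨ : Ψ.PosDef) (n : ℕ → ℕ) {K : ℕ} (hK : 1 ≤ K)
    (x : ℕ → Vec d) : ∃ c : ℝ≥0∞, c ≠ ∞ ∧ ∀ g : ℝ → ℝ≥0∞, Measurable g →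
      ∫⁻ μ, g (mahal Ψ n K x μ) = c * ∫⁻ y : Vec d, g (‖y‖ ^ 2) := by
  have hW := totalPrec_pos n hK
  refine ⟨ENNReal.ofReal (√(totalPrec n K) ^ d)⁻¹ *
    ENNReal.ofReal ((scatter Ψ n K x).det ^ (1 / 2 : ℝ)),
    ENNReal.mul_ne_top ENNReal.ofReal_ne_top ENNReal.ofReal_ne_top, fun g hg => ?_⟩
  have hm : Measurable fun y : Vec d => g (quad (scatter Ψ n K x)⁻¹ y) :=
    hg.comp (measurable_quad measurable_const measurable_id)
  simp only [mahal]
  rw [lintegral_sub_right_eq_self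
      (fun y : Vec d => g (quad (scatter Ψ n K x)⁻¹ (√(totalPrec n K) • y))) (wmean n K x),
    lintegral_smul_vec (Real.sqrt_pos.2 hW) hm, lintegral_quad_inv (scatter_posDef hΨ n K x) hg,
    mul_assoc]

theorem muWeight_mass_ne_top {Ψ Ψp : Mat d} (hΨ : Ψ.PosDef) (hΨp : Ψp.PosDef) (α : Vec d) {ν νp : ℝ}
    (hνp : 0 ≤ νp + 1) (n : ℕ → ℕ) {K : ℕ} (hK : 1 ≤ K) (hm : (d : ℝ) < ν + K) (x : ℕ → Vec d) :
    ∫⁻ μ, muWeight α Ψ ν Ψp νp n K x μ ≠ ∞ := by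
  obtain ⟨c, hc, h⟩ := exists_lintegral_mahal hΨ n hK x
  have h1 := h (fun r => ENNReal.ofReal ((1 + r) ^ (-((ν + K) / 2)))) (by fun_prop)
  have h2 : c * tMass d ((ν + K) / 2) ≠ ∞ := ENNReal.mul_ne_top hc (tMass_ne_top (by linarith))
  rw [tMass, ← h1] at h2
  refine ne_top_of_le_ne_top h2 (lintegral_mono fun μ => ?_)
  refine mul_le_of_le_one_left' ?_
  rw [ENNReal.ofReal_le_one]
  exact priorMu_le_one hΨp hνp α μ

theorem muWeight_mass_ne_zero {Ψ Ψp : Mat d} (hΨ : Ψ.PosDef) (hΨp : Ψp.PosDef) (α : Vec d)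
    (ν νp : ℝ) (n : ℕ → ℕ) (K : ℕ) (x : ℕ → Vec d) :
    ∫⁻ μ, muWeight α Ψ ν Ψp νp n K x μ ≠ 0 := by
  rw [Ne, lintegral_eq_zero_iff (measurable_muWeight α Ψ ν Ψp νp n K x)]
  intro h
  have : ∀ᵐ y : Vec d, False := by
    filter_upwards [h] with μ hμ
    have h1 := quad_inv_nonneg hΨp (μ - α)
    have h2 := mahal_nonneg hΨ n K x μ
    simp only [Pi.zero_apply, muWeight, mul_eq_zero, ENNReal.ofReal_eq_zero, priorMu] at hμ
    rcases hμ with hμ | hμ <;> exact absurd hμ (not_le.2 (by positivity))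
  rw [eventually_false_iff_eq_bot, ae_eq_bot] at this
  exact NeZero.ne (volume : Measure (Vec d)) this

/-- Under the kernel `(1 + ‖y‖²) ^ (-a)` most of the mass lies in the unit ball. -/
theorem tMass_le_ball (hd : 1 ≤ d) {a : ℝ} (ha : (d : ℝ) + 2 < 2 * a)
    (hρ : d / (2 * a - 2 - d) < 1) :
    ENNReal.ofReal (1 - d / (2 * a - 2 - d)) * tMass d a ≤
      ∫⁻ y : Vec d, (Set.Iic (1 : ℝ)).indicator (fun r => ENNReal.ofReal ((1 + r) ^ (-a)))
        (‖y‖ ^ 2) := by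
  set ρ := d / (2 * a - 2 - d)
  have hρ0 : 0 ≤ ρ := div_nonneg (Nat.cast_nonneg d) (by linarith)
  have hJ : tMass d a ≠ ∞ := tMass_ne_top (by linarith)
  have hfin : ENNReal.ofReal ρ * tMass d a ≠ ∞ := ENNReal.mul_ne_top ENNReal.ofReal_ne_top hJ
  have hm : Measurable fun y : Vec d =>
      (Set.Iic (1 : ℝ)).indicator (fun r => ENNReal.ofReal ((1 + r) ^ (-a))) (‖y‖ ^ 2) :=
    (Measurable.indicator (by fun_prop) measurableSet_Iic).comp
      (g := (Set.Iic (1 : ℝ)).indicator (fun r => ENNReal.ofReal ((1 + r) ^ (-a))))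
      (f := fun y : Vec d => ‖y‖ ^ 2) (by fun_prop)
  rw [← ENNReal.add_le_add_iff_right hfin, ← add_mul, ← ENNReal.ofReal_add (by linarith) hρ0,
    sub_add_cancel, ENNReal.ofReal_one, one_mul, ← lintegral_norm_sq_t hd ha,
    ← lintegral_add_left hm, tMass]
  -- Markov's inequality: outside the unit ball 1 ≤ ‖y‖², so the missing mass is bounded by the
  -- second moment.
  refine lintegral_mono fun y => ?_
  by_cases h : ‖y‖ ^ 2 ≤ 1
  · rw [Set.indicator_of_mem (by exact h)]
    exact le_self_add
  · refine le_trans ?_ le_add_self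
    refine le_mul_of_one_le_left' ?_
    rw [ENNReal.one_le_ofReal]
    exact (not_le.1 h).le

/-- The numerator is bounded with `priorMu` ≤ 1, giving ρ times the t mass; the mass is bounded
below by its part on `mahal` ≤ 1, where `priorMu` ≥ b and at least a fraction 1 − ρ of the t mass
lies. -/
theorem lintegral_mahal_muWeight_le (hd : 1 ≤ d) {Ψ Ψp : Mat d} (hΨ : Ψ.PosDef) (hΨp : Ψp.PosDef)
    (α : Vec d) {ν νp : ℝ} (hνp : 0 ≤ νp + 1) (n : ℕ → ℕ) {K : ℕ} (hK : 1 ≤ K)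
    (hm : (d : ℝ) + 2 < ν + K) (hρ : d / (ν + K - 2 - d) < 1) (x : ℕ → Vec d) {b : ℝ} (hb : 0 < b)
    (hlow : ∀ μ, mahal Ψ n K x μ ≤ 1 → b ≤ priorMu α Ψp νp μ) :
    ∫⁻ μ, ENNReal.ofReal (mahal Ψ n K x μ) * muWeight α Ψ ν Ψp νp n K x μ ≤
      ENNReal.ofReal (d / (ν + K - 2 - d) / (b * (1 - d / (ν + K - 2 - d)))) *
        ∫⁻ μ, muWeight α Ψ ν Ψp νp n K x μ := by
  obtain ⟨c, hc, h⟩ := exists_lintegral_mahal hΨ n hK x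
  have ha : (d : ℝ) + 2 < 2 * ((ν + K) / 2) := by linarith
  have e2 : 2 * ((ν + K) / 2) = ν + K := by ring
  have hball := tMass_le_ball hd ha (by rwa [e2])
  have hmom := lintegral_norm_sq_t hd ha
  rw [e2] at hball hmom
  set ρ := d / (ν + K - 2 - d)
  have hρ0 : 0 ≤ ρ := div_nonneg (Nat.cast_nonneg d) (by linarith)
  have hup : ∫⁻ μ, ENNReal.ofReal (mahal Ψ n K x μ) * muWeight α Ψ ν Ψp νp n K x μ ≤
      c * (ENNReal.ofReal ρ * tMass d ((ν + K) / 2)) := by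
    rw [← hmom, ← h (fun r => ENNReal.ofReal r * ENNReal.ofReal ((1 + r) ^ (-((ν + K) / 2))))
      (by fun_prop)]
    refine lintegral_mono fun μ => mul_le_mul_right (mul_le_of_le_one_left' ?_) _
    rw [ENNReal.ofReal_le_one]
    exact priorMu_le_one hΨp hνp α μ
  have hlo : ENNReal.ofReal b * (c * (ENNReal.ofReal (1 - ρ) * tMass d ((ν + K) / 2))) ≤
      ∫⁻ μ, muWeight α Ψ ν Ψp νp n K x μ := by
    have hmi : Measurable ((Set.Iic (1 : ℝ)).indicator
        (fun r => ENNReal.ofReal ((1 + r) ^ (-((ν + K) / 2))))) :=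
      Measurable.indicator (by fun_prop) measurableSet_Iic
    have hmi' : Measurable fun μ => (Set.Iic (1 : ℝ)).indicator
        (fun r => ENNReal.ofReal ((1 + r) ^ (-((ν + K) / 2)))) (mahal Ψ n K x μ) :=
      hmi.comp (measurable_mahal Ψ n K x)
    refine (mul_le_mul_right (mul_le_mul_right hball c) _).trans ?_
    rw [← h _ hmi, ← lintegral_const_mul _ hmi']
    refine lintegral_mono fun μ => ?_
    by_cases hμ : mahal Ψ n K x μ ≤ 1
    · rw [Set.indicator_of_mem (by exact hμ), muWeight]
      gcongr
      exact hlow μ hμ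
    · rw [Set.indicator_of_notMem (by exact hμ), mul_zero]
      exact zero_le
  refine hup.trans (le_trans (le_of_eq ?_) (mul_le_mul_right hlo _))
  have : ρ = ρ / (b * (1 - ρ)) * b * (1 - ρ) := by
    have : 1 - ρ ≠ 0 := by linarith
    field_simp
  have h1 : 0 < 1 - ρ := by linarith
  conv_lhs => rw [this, ENNReal.ofReal_mul (by positivity), ENNReal.ofReal_mul (by positivity)]
  ring

end Estimates

/-! ### Posterior means for a fixed data set. -/

/-- Admissible hyperparameters and batch sizes of the hierarchical model. -/
structure Model (d : ℕ) where
  one_le : 1 ≤ d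
  α : Vec d
  Ψ : Mat d
  Ψp : Mat d
  ν : ℝ
  νp : ℝ
  n : ℕ → ℕ
  posDef : Ψ.PosDef
  posDef' : Ψp.PosDef
  lt_ν : (d : ℝ) - 1 < ν
  lt_νp : (d : ℝ) - 1 < νp

namespace Model

variable {d : ℕ} (M : Model d)

theorem νp_nonneg : 0 ≤ M.νp + 1 := by
  have h1 := M.lt_νp
  have h2 : (0 : ℝ) ≤ d := Nat.cast_nonneg d
  linarith

/-- The posterior distribution after `K` observations. -/
noncomputable def post (K : ℕ) (x : ℕ → Vec d) : Measure (Param d) :=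
  posterior (prior M.α M.Ψ M.ν M.Ψp M.νp) M.n K x

noncomputable abbrev center (K : ℕ) (x : ℕ → Vec d) : Vec d := wmean M.n K x

noncomputable abbrev scat (K : ℕ) (x : ℕ → Vec d) : Mat d := scatter M.Ψ M.n K x

noncomputable abbrev total (K : ℕ) : ℝ := totalPrec M.n K

/-- A bound for the distance of `μ` from the prior mean on the set where `mahal ≤ 1`. -/
noncomputable def radius (K : ℕ) (x : ℕ → Vec d) : ℝ :=
  ‖M.center K x - M.α‖ + √((M.scat K x).trace / M.total K)

/-- The second moment of the multivariate `t` kernel which bounds the posterior of `μ`. -/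
noncomputable def ratio (K : ℕ) : ℝ := d / (M.ν + K - 2 - d)

/-- A bound for the posterior mean of `mahal`. -/
noncomputable def rate (K : ℕ) (x : ℕ → Vec d) : ℝ :=
  M.ratio K / (priorLower M.Ψp M.νp (M.radius K x) * (1 - M.ratio K))

variable {K : ℕ}

theorem ratio_nonneg (hm : 2 * (d : ℝ) + 2 < M.ν + K) : 0 ≤ M.ratio K :=
  div_nonneg (Nat.cast_nonneg d) (by linarith [(Nat.cast_nonneg d : (0 : ℝ) ≤ d)])

/-- This is where the regime 2d + 2 < ν + K comes from; it also covers every integrability condition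
used below. -/
theorem ratio_lt_one (hm : 2 * (d : ℝ) + 2 < M.ν + K) : M.ratio K < 1 := by
  have : (0 : ℝ) ≤ d := Nat.cast_nonneg d
  rw [ratio, div_lt_one (by linarith)]
  linarith

theorem rate_nonneg (hm : 2 * (d : ℝ) + 2 < M.ν + K) (x : ℕ → Vec d) : 0 ≤ M.rate K x := by
  have h1 := M.ratio_nonneg hm
  have h2 := M.ratio_lt_one hm
  exact div_nonneg h1 (mul_nonneg (priorLower_pos _ _ _).le (by linarith))

theorem lintegral_post (K : ℕ) (x : ℕ → Vec d) {F : Vec d × Mat d → ℝ≥0∞} (hF : Measurable F) :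
    ∫⁻ θ, F (θ.1, θ.2.1) ∂M.post K x =
      (postNum M.α M.Ψ M.ν M.Ψp M.νp M.n K x fun _ => 1)⁻¹ *
        postNum M.α M.Ψ M.ν M.Ψp M.νp M.n K x F :=
  lintegral_posterior M.posDef M.posDef' M.lt_ν M.lt_νp M.α M.n K x hF

/-- The unnormalised marginal posterior density of `μ`. -/
noncomputable abbrev weight (K : ℕ) (x : ℕ → Vec d) : Vec d → ℝ≥0∞ :=
  muWeight M.α M.Ψ M.ν M.Ψp M.νp M.n K x

theorem lintegral_post_fst (hK : 1 ≤ K) (x : ℕ → Vec d)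
    {F : Vec d → ℝ≥0∞} (hF : Measurable F) :
    ∫⁻ θ, F θ.1 ∂M.post K x = (∫⁻ μ, M.weight K x μ)⁻¹ * ∫⁻ μ, F μ * M.weight K x μ := by
  have hdet := (scatter_posDef M.posDef M.n K x).det_pos
  have h0 : ENNReal.ofReal ((scatter M.Ψ M.n K x).det ^ (-(M.ν + K) / 2)) *
      iwMass (M.ν + K) (1 : Mat d) ≠ 0 := by
    refine mul_ne_zero ?_ (iwMass_one_ne_zero _)
    simp only [ne_eq, ENNReal.ofReal_eq_zero, not_le]
    positivity
  have ht : ENNReal.ofReal ((scatter M.Ψ M.n K x).det ^ (-(M.ν + K) / 2)) *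
      iwMass (M.ν + K) (1 : Mat d) ≠ ∞ :=
    ENNReal.mul_ne_top ENNReal.ofReal_ne_top (iwMass_one_ne_top
      (by linarith [M.lt_ν, (Nat.cast_nonneg K : (0 : ℝ) ≤ K)]))
  have h1 := postNum_fst M.posDef M.α M.ν M.Ψp M.νp M.n hK x (F := fun _ => 1) measurable_const
  simp only [one_mul] at h1
  rw [M.lintegral_post K x (F := fun p => F p.1) (hF.comp measurable_fst), h1,
    postNum_fst M.posDef M.α M.ν M.Ψp M.νp M.n hK x hF, ENNReal.mul_inv (Or.inl h0) (Or.inl ht),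
    mul_mul_mul_comm, ENNReal.inv_mul_cancel h0 ht, one_mul]

theorem weight_mass_ne_zero (K : ℕ) (x : ℕ → Vec d) : ∫⁻ μ, M.weight K x μ ≠ 0 :=
  muWeight_mass_ne_zero M.posDef M.posDef' M.α M.ν M.νp M.n K x

theorem weight_mass_ne_top (hK : 1 ≤ K) (hm : 2 * (d : ℝ) + 2 < M.ν + K) (x : ℕ → Vec d) :
    ∫⁻ μ, M.weight K x μ ≠ ∞ :=
  muWeight_mass_ne_top M.posDef M.posDef' M.α M.νp_nonneg M.n hK
    (by linarith [(Nat.cast_nonneg d : (0 : ℝ) ≤ d)]) x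

theorem isProbabilityMeasure_post (hK : 1 ≤ K) (hm : 2 * (d : ℝ) + 2 < M.ν + K) (x : ℕ → Vec d) :
    IsProbabilityMeasure (M.post K x) := by
  constructor
  have h := M.lintegral_post_fst hK x (F := fun _ => 1) measurable_const
  simpa [ENNReal.inv_mul_cancel (M.weight_mass_ne_zero K x) (M.weight_mass_ne_top hK hm x)] using h

theorem lintegral_mahal_post_le (hK : 1 ≤ K) (hm : 2 * (d : ℝ) + 2 < M.ν + K) (x : ℕ → Vec d) :
    ∫⁻ θ, ENNReal.ofReal (mahal M.Ψ M.n K x θ.1) ∂M.post K x ≤ ENNReal.ofReal (M.rate K x) := by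
  have hd : (0 : ℝ) ≤ d := Nat.cast_nonneg d
  have hW := totalPrec_pos M.n hK
  have hlow : ∀ μ, mahal M.Ψ M.n K x μ ≤ 1 →
      priorLower M.Ψp M.νp (M.radius K x) ≤ priorMu M.α M.Ψp M.νp μ := by
    intro μ hμ
    refine priorLower_le M.posDef' M.νp_nonneg ?_
    have htr := (scatter_posDef M.posDef M.n K x).posSemidef.trace_nonneg
    have h1 : ‖μ - M.center K x‖ ≤ √((M.scat K x).trace / M.total K) :=
      Real.le_sqrt_of_sq_le ((norm_sub_wmean_sq_le M.posDef M.n hK x μ).trans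
        (mul_le_of_le_one_right (div_nonneg htr hW.le) hμ))
    calc ‖μ - M.α‖ = ‖(M.center K x - M.α) + (μ - M.center K x)‖ := by congr 1; abel
      _ ≤ ‖M.center K x - M.α‖ + ‖μ - M.center K x‖ := norm_add_le _ _
      _ ≤ M.radius K x := by unfold radius; gcongr
  have h := lintegral_mahal_muWeight_le M.one_le M.posDef M.posDef' M.α M.νp_nonneg M.n hK
    (by linarith) (M.ratio_lt_one hm) x (priorLower_pos _ _ _) hlow
  rw [M.lintegral_post_fst hK x (F := fun μ => ENNReal.ofReal (mahal M.Ψ M.n K x μ))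
    (measurable_mahal M.Ψ M.n K x).ennreal_ofReal]
  refine (mul_le_mul_right h _).trans (le_of_eq ?_)
  rw [mul_left_comm, ENNReal.inv_mul_cancel (M.weight_mass_ne_zero K x)
    (M.weight_mass_ne_top hK hm x), mul_one]
  rfl

theorem lintegral_mul_mahal_post_le (hK : 1 ≤ K) (hm : 2 * (d : ℝ) + 2 < M.ν + K) (x : ℕ → Vec d)
    {c : ℝ} (hc : 0 ≤ c) {f : Vec d → ℝ} (hf : ∀ μ, f μ ≤ c * mahal M.Ψ M.n K x μ) :
    ∫⁻ θ, ENNReal.ofReal (f θ.1) ∂M.post K x ≤ ENNReal.ofReal (c * M.rate K x) := by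
  have hmeas : Measurable fun θ : Param d => ENNReal.ofReal (mahal M.Ψ M.n K x θ.1) :=
    ((measurable_mahal M.Ψ M.n K x).comp measurable_fst).ennreal_ofReal
  calc ∫⁻ θ, ENNReal.ofReal (f θ.1) ∂M.post K x
      ≤ ∫⁻ θ, ENNReal.ofReal c * ENNReal.ofReal (mahal M.Ψ M.n K x θ.1) ∂M.post K x := by
        refine lintegral_mono fun θ => ?_
        rw [← ENNReal.ofReal_mul hc]
        exact ENNReal.ofReal_le_ofReal (hf _)
    _ ≤ ENNReal.ofReal (c * M.rate K x) := by
        rw [lintegral_const_mul _ hmeas, ENNReal.ofReal_mul hc]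
        exact mul_le_mul_right (M.lintegral_mahal_post_le hK hm x) _

theorem ae_posDef (K : ℕ) (x : ℕ → Vec d) : ∀ᵐ θ ∂M.post K x, θ.2.1.PosDef := by
  have hs : MeasurableSet {p : Vec d × Mat d | ¬ p.2.PosDef} :=
    (measurable_snd measurableSet_posDef).compl
  have h := M.lintegral_post K x
    (F := {p : Vec d × Mat d | ¬ p.2.PosDef}.indicator fun _ => 1)
    (measurable_const.indicator hs)
  have h0 : postNum M.α M.Ψ M.ν M.Ψp M.νp M.n K x
      ({p : Vec d × Mat d | ¬ p.2.PosDef}.indicator fun _ => 1) = 0 := by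
    rw [postNum]
    refine (lintegral_congr fun μ => ?_).trans lintegral_zero
    have : ∀ S : Mat d, ({p : Vec d × Mat d | ¬ p.2.PosDef}.indicator (fun _ => 1) (μ, S) : ℝ≥0∞) *
        ENNReal.ofReal (iwKernel (M.ν + K) (scaleMat M.Ψ M.n K x μ) S) = 0 := fun S => by
      by_cases hS : S.PosDef
      · rw [Set.indicator_of_notMem (by simpa using hS), zero_mul]
      · rw [iwKernel_of_not_posDef hS, ENNReal.ofReal_zero, mul_zero]
    simp only [this, lintegral_zero, mul_zero]
  rw [h0, mul_zero] at h
  have hs' : MeasurableSet {θ : Param d | ¬ θ.2.1.PosDef} :=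
    ((measurable_fst.comp measurable_snd) measurableSet_posDef).compl
  rw [ae_iff, ← lintegral_indicator_one hs', ← h]
  rfl

theorem integrable_fst (hK : 1 ≤ K) (hm : 2 * (d : ℝ) + 2 < M.ν + K) (x : ℕ → Vec d) :
    Integrable (fun θ : Param d => ‖θ.1 - M.center K x‖ ^ 2) (M.post K x) ∧
    Integrable (fun θ : Param d => θ.1) (M.post K x) ∧
    ∫ θ, ‖θ.1 - M.center K x‖ ^ 2 ∂M.post K x ≤
      (M.scat K x).trace / M.total K * M.rate K x := by
  have := M.isProbabilityMeasure_post hK hm x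
  have hW := totalPrec_pos M.n hK
  have htr := (scatter_posDef M.posDef M.n K x).posSemidef.trace_nonneg
  have hc : 0 ≤ (M.scat K x).trace / M.total K := div_nonneg htr hW.le
  have hle := M.lintegral_mul_mahal_post_le hK hm x hc
    (f := fun μ => ‖μ - M.center K x‖ ^ 2) (norm_sub_wmean_sq_le M.posDef M.n hK x)
  have hmeas : Measurable fun θ : Param d => ‖θ.1 - M.center K x‖ ^ 2 := by fun_prop
  have hint : Integrable (fun θ : Param d => ‖θ.1 - M.center K x‖ ^ 2) (M.post K x) := by
    refine ⟨hmeas.aestronglyMeasurable, ?_⟩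
    rw [hasFiniteIntegral_iff_ofReal (ae_of_all _ fun θ => sq_nonneg _)]
    exact hle.trans_lt ENNReal.ofReal_lt_top
  refine ⟨hint, ?_, ?_⟩
  · refine Integrable.mono' (hint.add (integrable_const (‖M.center K x‖ + 1)))
      measurable_fst.aestronglyMeasurable (ae_of_all _ fun θ => ?_)
    have h1 : ‖θ.1‖ ≤ ‖M.center K x‖ + ‖θ.1 - M.center K x‖ := by
      simpa using norm_add_le (M.center K x) (θ.1 - M.center K x)
    simp only [Pi.add_apply]
    nlinarith [sq_nonneg (‖θ.1 - M.center K x‖ - 1), norm_nonneg (θ.1 - M.center K x)]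
  · rw [integral_eq_lintegral_of_nonneg_ae (ae_of_all _ fun θ => sq_nonneg _)
      hmeas.aestronglyMeasurable]
    exact ENNReal.toReal_le_of_le_ofReal (mul_nonneg hc (M.rate_nonneg hm x)) hle

/-- The inequality t ≤ δ + t²/δ converts the second-moment bound into a first-moment one. -/
theorem norm_meanMu_sub_le (hK : 1 ≤ K) (hm : 2 * (d : ℝ) + 2 < M.ν + K) (x : ℕ → Vec d)
    {δ : ℝ} (hδ : 0 < δ) :
    ‖meanMu (M.post K x) - M.center K x‖ ≤
      δ + (M.scat K x).trace / M.total K * M.rate K x / δ := by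
  have := M.isProbabilityMeasure_post hK hm x
  obtain ⟨h1, h2, h3⟩ := M.integrable_fst hK hm x
  have e : meanMu (M.post K x) - M.center K x = ∫ θ, (θ.1 - M.center K x) ∂M.post K x := by
    rw [integral_sub h2 (integrable_const _), meanMu]
    simp
  rw [e]
  calc ‖∫ θ, (θ.1 - M.center K x) ∂M.post K x‖ ≤ ∫ θ, ‖θ.1 - M.center K x‖ ∂M.post K x :=
        norm_integral_le_integral_norm _
    _ ≤ ∫ θ, (δ + ‖θ.1 - M.center K x‖ ^ 2 / δ) ∂M.post K x := by
        refine integral_mono (h2.sub (integrable_const _)).norm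
          ((integrable_const _).add (h1.div_const _)) fun θ => ?_
        have : 0 < δ := hδ
        have h4 : δ + ‖θ.1 - M.center K x‖ ^ 2 / δ - ‖θ.1 - M.center K x‖ =
            ((δ - ‖θ.1 - M.center K x‖) ^ 2 + δ * ‖θ.1 - M.center K x‖) / δ := by
          field_simp; ring
        have h5 : 0 ≤ ((δ - ‖θ.1 - M.center K x‖) ^ 2 + δ * ‖θ.1 - M.center K x‖) / δ := by
          positivity
        dsimp only
        linarith
    _ = δ + (∫ θ, ‖θ.1 - M.center K x‖ ^ 2 ∂M.post K x) / δ := by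
        rw [integral_add (integrable_const _) (h1.div_const _), integral_div]
        simp
    _ ≤ _ := by gcongr

/-- The excess e is the posterior mean of W ⟨v, μ − m⟩², controlled by Cauchy–Schwarz for the
scatter matrix and the bound on the mean of `mahal`. -/
theorem exists_lintegral_quad (hK : 1 ≤ K) (hm : 2 * (d : ℝ) + 2 < M.ν + K) (x : ℕ → Vec d)
    (v : Vec d) : ∃ e : ℝ, 0 ≤ e ∧ e ≤ quad (M.scat K x) v * M.rate K x ∧
      ∫⁻ θ, ENNReal.ofReal (quad θ.2.1 v) ∂M.post K x =
        ENNReal.ofReal ((quad (M.scat K x) v + e) / (M.ν + K - d - 1)) := by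
  have := M.isProbabilityMeasure_post hK hm x
  have hd : (0 : ℝ) ≤ d := Nat.cast_nonneg d
  have hA := quad_nonneg (scatter_posDef M.posDef M.n K x).posSemidef v
  have hden : 0 ≤ (M.ν + K - d - 1)⁻¹ := inv_nonneg.2 (by linarith)
  have hW := totalPrec_pos M.n hK
  have hq : Measurable fun p : Vec d × Mat d => ENNReal.ofReal (quad p.2 v) :=
    (measurable_quad measurable_snd measurable_const).ennreal_ofReal
  have hq2 : Measurable fun p : Vec d × Mat d =>
      ENNReal.ofReal (quad (scaleMat M.Ψ M.n K x p.1) v / (M.ν + K - d - 1)) :=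
    ((measurable_quad ((measurable_scaleMat M.Ψ M.n K x).comp measurable_fst)
      measurable_const).div_const _).ennreal_ofReal
  set E := ∫⁻ θ, ENNReal.ofReal (M.total K * inner ℝ v (θ.1 - M.center K x) ^ 2) ∂M.post K x with hE
  have hEle : E ≤ ENNReal.ofReal (quad (M.scat K x) v * M.rate K x) :=
    M.lintegral_mul_mahal_post_le hK hm x hA
      (f := fun μ => M.total K * inner ℝ v (μ - M.center K x) ^ 2)
      (totalPrec_mul_inner_sq_le M.posDef M.n hK x v)
  have hEt : E ≠ ∞ := ne_top_of_le_ne_top ENNReal.ofReal_ne_top hEle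
  refine ⟨E.toReal, ENNReal.toReal_nonneg,
    ENNReal.toReal_le_of_le_ofReal (mul_nonneg hA (M.rate_nonneg hm x)) hEle, ?_⟩
  have h1 := M.lintegral_post K x hq
  rw [postNum_quad M.one_le M.posDef M.α M.Ψp M.νp M.n (by linarith) x v,
    ← M.lintegral_post K x hq2] at h1
  rw [h1]
  have h2 : ∀ θ : Param d, ENNReal.ofReal (quad (scaleMat M.Ψ M.n K x θ.1) v / (M.ν + K - d - 1)) =
      ENNReal.ofReal (M.ν + K - d - 1)⁻¹ * (ENNReal.ofReal (quad (M.scat K x) v) +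
        ENNReal.ofReal (M.total K * inner ℝ v (θ.1 - M.center K x) ^ 2)) := fun θ => by
    rw [← ENNReal.ofReal_add hA (by positivity), ← ENNReal.ofReal_mul hden, scaleMat_eq _ _ hK,
      quad_add, quad_outer, inner_smul_right, mul_pow, Real.sq_sqrt hW.le, div_eq_inv_mul]
    rfl
  dsimp only
  simp only [h2]
  rw [lintegral_const_mul _ (by fun_prop), lintegral_add_left measurable_const, ← hE,
    lintegral_const, measure_univ, mul_one, ← ENNReal.ofReal_toReal hEt,
    ENNReal.toReal_ofReal ENNReal.toReal_nonneg, ← ENNReal.ofReal_add hA ENNReal.toReal_nonneg,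
    ← ENNReal.ofReal_mul hden, div_eq_inv_mul]

theorem integrable_quad (hK : 1 ≤ K) (hm : 2 * (d : ℝ) + 2 < M.ν + K) (x : ℕ → Vec d)
    (v : Vec d) : Integrable (fun θ : Param d => quad θ.2.1 v) (M.post K x) := by
  obtain ⟨e, -, -, h⟩ := M.exists_lintegral_quad hK hm x v
  refine ⟨(measurable_quad (measurable_fst.comp measurable_snd)
    measurable_const).aestronglyMeasurable, ?_⟩
  rw [hasFiniteIntegral_iff_ofReal, h]
  · exact ENNReal.ofReal_lt_top
  · filter_upwards [M.ae_posDef K x] with θ hθ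
    exact quad_nonneg hθ.posSemidef v

theorem exists_integral_quad (hK : 1 ≤ K) (hm : 2 * (d : ℝ) + 2 < M.ν + K) (x : ℕ → Vec d)
    (v : Vec d) : ∃ e : ℝ, 0 ≤ e ∧ e ≤ quad (M.scat K x) v * M.rate K x ∧
      ∫ θ, quad θ.2.1 v ∂M.post K x = (quad (M.scat K x) v + e) / (M.ν + K - d - 1) := by
  obtain ⟨e, h0, h1, h⟩ := M.exists_lintegral_quad hK hm x v
  have hd : (0 : ℝ) ≤ d := Nat.cast_nonneg d
  have hA := quad_nonneg (scatter_posDef M.posDef M.n K x).posSemidef v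
  refine ⟨e, h0, h1, ?_⟩
  rw [integral_eq_lintegral_of_nonneg_ae, h, ENNReal.toReal_ofReal]
  · exact div_nonneg (add_nonneg hA h0) (by linarith)
  · filter_upwards [M.ae_posDef K x] with θ hθ
    exact quad_nonneg hθ.posSemidef v
  · exact (M.integrable_quad hK hm x v).1

theorem integrable_entry (hK : 1 ≤ K) (hm : 2 * (d : ℝ) + 2 < M.ν + K) (x : ℕ → Vec d)
    (i j : Fin d) : Integrable (fun θ : Param d => θ.2.1 i j) (M.post K x) := by
  have h := fun i => M.integrable_quad hK hm x (EuclideanSpace.single i 1)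
  simp only [quad_single] at h
  refine Integrable.mono' (((h i).add (h j)).div_const 2)
    ((measurable_entry i j).comp (measurable_fst.comp measurable_snd)).aestronglyMeasurable ?_
  filter_upwards [M.ae_posDef K x] with θ hθ
  exact abs_entry_le hθ.posSemidef i j

/-- Polarization under the integral; Σ is symmetric only almost surely, as the prior lives on all
matrices. -/
theorem meanSigma_apply (hK : 1 ≤ K) (hm : 2 * (d : ℝ) + 2 < M.ν + K) (x : ℕ → Vec d)
    (i j : Fin d) : meanSigma (M.post K x) i j =
      ((∫ θ, quad θ.2.1 (EuclideanSpace.single i 1 + EuclideanSpace.single j 1) ∂M.post K x) -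
        (∫ θ, quad θ.2.1 (EuclideanSpace.single i 1) ∂M.post K x) -
        ∫ θ, quad θ.2.1 (EuclideanSpace.single j 1) ∂M.post K x) / 2 := by
  have hab : Integrable (fun θ : Param d =>
      quad θ.2.1 (EuclideanSpace.single i 1 + EuclideanSpace.single j 1) -
        quad θ.2.1 (EuclideanSpace.single i 1)) (M.post K x) :=
    (M.integrable_quad hK hm x _).sub (M.integrable_quad hK hm x _)
  rw [← integral_sub (M.integrable_quad hK hm x _) (M.integrable_quad hK hm x _),
    ← integral_sub hab (M.integrable_quad hK hm x _), ← integral_div, meanSigma, Matrix.of_apply]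
  refine integral_congr_ae ?_
  filter_upwards [M.ae_posDef K x] with θ hθ
  rw [quad_add_single (posDef_iff_quad.1 hθ).1, quad_single, quad_single]
  ring

end Model

/-! ### Deterministic limits along an arbitrary filter. -/

namespace Model

variable {d : ℕ} (M : Model d)

/-- The test vector `e_i + e_j`. -/
noncomputable def testVec (i j : Fin d) : Vec d :=
  EuclideanSpace.single i 1 + EuclideanSpace.single j 1

/-- Since `testVec i i` is 2 e_i, the single family of test vectors also controls the diagonal. -/
theorem quad_testVec_self (S : Mat d) (i : Fin d) :
    quad S (EuclideanSpace.single i 1) = quad S (testVec i i) / 4 := by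
  rw [testVec, ← two_smul ℝ, quad_smul_right]
  ring

section Limit

variable {ι : Type*} {l : Filter ι} {k : ι → ℕ} {X : ι → ℕ → Vec d} {μ₀ : Vec d} {S₀ : Mat d}

theorem eventually_regime (hk : Tendsto k l atTop) :
    ∀ᶠ i in l, 1 ≤ k i ∧ 2 * (d : ℝ) + 2 < M.ν + k i := by
  have h1 : Tendsto (fun i => M.ν + (k i : ℝ)) l atTop :=
    tendsto_atTop_add_const_left _ _ (tendsto_natCast_atTop_atTop.comp hk)
  exact (hk.eventually_ge_atTop 1).and (h1.eventually_gt_atTop _)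

theorem tendsto_ratio (hk : Tendsto k l atTop) : Tendsto (fun i => M.ratio (k i)) l (𝓝 0) := by
  have h1 : Tendsto (fun i => M.ν + (k i : ℝ) - 2 - d) l atTop := by
    simp only [sub_eq_add_neg]
    exact tendsto_atTop_add_const_right _ _ (tendsto_atTop_add_const_right _ _
      (tendsto_atTop_add_const_left _ _ (tendsto_natCast_atTop_atTop.comp hk)))
  exact h1.const_div_atTop _

theorem eventually_trace_le (hk : Tendsto k l atTop)
    (hS : ∀ i j, Tendsto (fun a => quad (M.scat (k a) (X a)) (testVec i j) / k a) l
      (𝓝 (quad S₀ (testVec i j)))) :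
    ∃ T : ℝ, ∀ᶠ a in l, (M.scat (k a) (X a)).trace / M.total (k a) ≤ T := by
  have h1 : Tendsto (fun a => ∑ i, quad (M.scat (k a) (X a)) (testVec i i) / k a / 4) l
      (𝓝 (∑ i, quad S₀ (testVec i i) / 4)) :=
    tendsto_finsetSum _ fun i _ => (hS i i).div_const 4
  -- The sum is tr S₀; the factor 2 comes from W ≥ K/2.
  refine ⟨2 * (∑ i, quad S₀ (testVec i i) / 4 + 1), ?_⟩
  filter_upwards [h1.eventually_lt_const (lt_add_one _), hk.eventually_ge_atTop 1] with a ha hka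
  have hka' : (0 : ℝ) < k a := by exact_mod_cast hka
  have htr := (scatter_posDef M.posDef M.n (k a) (X a)).posSemidef.trace_nonneg
  have e : ∑ i, quad (M.scat (k a) (X a)) (testVec i i) / k a / 4 =
      (M.scat (k a) (X a)).trace / k a := by
    rw [trace, Finset.sum_div]
    refine Finset.sum_congr rfl fun i _ => ?_
    rw [diag_apply, ← quad_single (M.scat (k a) (X a)) i, quad_testVec_self]
    ring
  rw [e] at ha
  have hh : (M.scat (k a) (X a)).trace / M.total (k a) ≤
      (M.scat (k a) (X a)).trace / ((k a : ℝ) / 2) := by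
    gcongr
    exact half_le_totalPrec M.n (k a)
  refine hh.trans ?_
  rw [div_div_eq_mul_div, mul_div_right_comm, mul_comm]
  linarith

/-- The radius stays bounded by a fixed R, so the prior's lower bound stays away from 0 while the
ratio vanishes. -/
theorem tendsto_rate (hk : Tendsto k l atTop)
    (hμ : Tendsto (fun a => M.center (k a) (X a)) l (𝓝 μ₀))
    (hS : ∀ i j, Tendsto (fun a => quad (M.scat (k a) (X a)) (testVec i j) / k a) l
      (𝓝 (quad S₀ (testVec i j)))) :
    Tendsto (fun a => M.rate (k a) (X a)) l (𝓝 0) := by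
  obtain ⟨T, hT⟩ := M.eventually_trace_le hk hS
  set R := ‖μ₀ - M.α‖ + 1 + √T
  have hb := priorLower_pos M.Ψp M.νp R
  have hr := M.tendsto_ratio hk
  have hlim : Tendsto (fun a => M.ratio (k a) / (priorLower M.Ψp M.νp R * (1 - M.ratio (k a)))) l
      (𝓝 0) := by
    have := hr.div ((hr.const_sub 1).const_mul (priorLower M.Ψp M.νp R)) (by simpa using hb.ne')
    simpa [Pi.div_def] using this
  have hc : ∀ᶠ a in l, ‖M.center (k a) (X a) - M.α‖ < ‖μ₀ - M.α‖ + 1 :=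
    (hμ.sub_const M.α).norm.eventually_lt_const (lt_add_one _)
  refine tendsto_of_tendsto_of_tendsto_of_le_of_le' tendsto_const_nhds hlim ?_ ?_
  · filter_upwards [M.eventually_regime hk] with a ha
    exact M.rate_nonneg ha.2 _
  · filter_upwards [M.eventually_regime hk, hc, hT] with a ha hca hTa
    have h1 := M.ratio_nonneg ha.2
    have h2 := M.ratio_lt_one ha.2
    have hrad : M.radius (k a) (X a) ≤ R := add_le_add hca.le (Real.sqrt_le_sqrt hTa)
    have hrad0 : 0 ≤ M.radius (k a) (X a) := add_nonneg (norm_nonneg _) (Real.sqrt_nonneg _)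
    have h3 : 0 < 1 - M.ratio (k a) := by linarith
    unfold rate
    gcongr
    exact priorLower_anti M.νp_nonneg hrad0 hrad

theorem tendsto_meanMu (hk : Tendsto k l atTop)
    (hμ : Tendsto (fun a => M.center (k a) (X a)) l (𝓝 μ₀))
    (hS : ∀ i j, Tendsto (fun a => quad (M.scat (k a) (X a)) (testVec i j) / k a) l
      (𝓝 (quad S₀ (testVec i j)))) :
    Tendsto (fun a => meanMu (M.post (k a) (X a))) l (𝓝 μ₀) := by
  obtain ⟨T, hT⟩ := M.eventually_trace_le hk hS
  have hr := M.tendsto_rate hk hμ hS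
  have h0 : Tendsto (fun a => meanMu (M.post (k a) (X a)) - M.center (k a) (X a)) l (𝓝 0) := by
    rw [Metric.tendsto_nhds]
    intro ε hε
    have h1 : Tendsto (fun a => T * M.rate (k a) (X a) / (ε / 2)) l (𝓝 0) := by
      simpa using (hr.const_mul T).div_const (ε / 2)
    filter_upwards [M.eventually_regime hk, hT, h1.eventually_lt_const (half_pos hε)] with a ha hTa h2
    rw [dist_zero_right]
    have hrate := M.rate_nonneg ha.2 (X a)
    have h4 : (M.scat (k a) (X a)).trace / M.total (k a) * M.rate (k a) (X a) / (ε / 2) ≤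
        T * M.rate (k a) (X a) / (ε / 2) := by gcongr
    linarith [M.norm_meanMu_sub_le ha.1 ha.2 (X a) (half_pos hε)]
  simpa using h0.add hμ

theorem tendsto_integral_quad (hk : Tendsto k l atTop)
    (hr : Tendsto (fun a => M.rate (k a) (X a)) l (𝓝 0)) {v : Vec d}
    (hS : Tendsto (fun a => quad (M.scat (k a) (X a)) v / k a) l (𝓝 (quad S₀ v))) :
    Tendsto (fun a => ∫ θ, quad θ.2.1 v ∂M.post (k a) (X a)) l (𝓝 (quad S₀ v)) := by
  have hkr : Tendsto (fun a => (k a : ℝ)) l atTop := tendsto_natCast_atTop_atTop.comp hk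
  have hden : Tendsto (fun a => 1 + (M.ν - d - 1) / (k a : ℝ)) l (𝓝 1) := by
    simpa using (hkr.const_div_atTop (M.ν - d - 1)).const_add 1
  have hlo : Tendsto (fun a => quad (M.scat (k a) (X a)) v / k a /
      (1 + (M.ν - d - 1) / (k a : ℝ))) l (𝓝 (quad S₀ v)) := by
    simpa [Pi.div_def] using hS.div hden one_ne_zero
  have hup : Tendsto (fun a => quad (M.scat (k a) (X a)) v / k a * (1 + M.rate (k a) (X a)) /
      (1 + (M.ν - d - 1) / (k a : ℝ))) l (𝓝 (quad S₀ v)) := by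
    simpa [Pi.div_def] using (hS.mul (hr.const_add 1)).div hden one_ne_zero
  have hd : (0 : ℝ) ≤ d := Nat.cast_nonneg d
  have key : ∀ᶠ a in l, ∃ e : ℝ, 0 ≤ e ∧ e ≤ quad (M.scat (k a) (X a)) v * M.rate (k a) (X a) ∧
      ∫ θ, quad θ.2.1 v ∂M.post (k a) (X a) =
        (quad (M.scat (k a) (X a)) v + e) / (k a * (1 + (M.ν - d - 1) / (k a : ℝ))) ∧
      0 < (k a : ℝ) ∧ 0 < 1 + (M.ν - d - 1) / (k a : ℝ) := by
    filter_upwards [M.eventually_regime hk] with a ha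
    obtain ⟨e, h1, h2, h3⟩ := M.exists_integral_quad ha.1 ha.2 (X a) v
    have hka : (0 : ℝ) < k a := by exact_mod_cast ha.1
    have e1 : (k a : ℝ) * (1 + (M.ν - d - 1) / (k a : ℝ)) = M.ν + k a - d - 1 := by
      field_simp; ring
    refine ⟨e, h1, h2, by rw [h3, e1], hka, ?_⟩
    refine pos_of_mul_pos_right ?_ hka.le
    rw [e1]
    linarith [ha.2]
  refine tendsto_of_tendsto_of_tendsto_of_le_of_le' hlo hup ?_ ?_
  · filter_upwards [key] with a ⟨e, h1, h2, h3, h4, h5⟩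
    rw [h3, div_div]
    gcongr
    linarith
  · filter_upwards [key] with a ⟨e, h1, h2, h3, h4, h5⟩
    rw [h3, div_mul_eq_mul_div, div_div]
    gcongr
    linarith

theorem tendsto_meanSigma (hS₀ : S₀.IsSymm) (hk : Tendsto k l atTop)
    (hμ : Tendsto (fun a => M.center (k a) (X a)) l (𝓝 μ₀))
    (hS : ∀ i j, Tendsto (fun a => quad (M.scat (k a) (X a)) (testVec i j) / k a) l
      (𝓝 (quad S₀ (testVec i j)))) (i j : Fin d) :
    Tendsto (fun a => meanSigma (M.post (k a) (X a)) i j) l (𝓝 (S₀ i j)) := by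
  have hr := M.tendsto_rate hk hμ hS
  have hs : ∀ i, Tendsto (fun a => quad (M.scat (k a) (X a)) (EuclideanSpace.single i 1) / k a) l
      (𝓝 (quad S₀ (EuclideanSpace.single i 1))) := fun i => by
    simp only [quad_testVec_self, div_right_comm _ (4 : ℝ)]
    exact (hS i i).div_const 4
  have h := (((M.tendsto_integral_quad hk hr (hS i j)).sub
    (M.tendsto_integral_quad hk hr (hs i))).sub (M.tendsto_integral_quad hk hr (hs j))).div_const 2
  have e : (quad S₀ (testVec i j) - quad S₀ (EuclideanSpace.single i 1) -
      quad S₀ (EuclideanSpace.single j 1)) / 2 = S₀ i j := by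
    rw [testVec, quad_add_single hS₀, quad_single, quad_single]
    ring
  rw [e] at h
  refine h.congr' ?_
  filter_upwards [M.eventually_regime hk] with a ha
  rw [M.meanSigma_apply ha.1 ha.2]
  rfl

end Limit

end Model

/-! ### Laws of large numbers for the data. -/

section Data

variable {d : ℕ} {n : ℕ → ℕ} {μ₀ : Vec d} {S₀ : Mat d} {Ω : Type*} [MeasurableSpace Ω]
  {P : Measure Ω} {L : ℕ → Ω → Vec d}

/-- A linear functional of the standardised `j`-th observation. -/
noncomputable def stdObs (n : ℕ → ℕ) (μ₀ : Vec d) (v : Vec d) (j : ℕ) (x : Vec d) : ℝ :=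
  √(prec n j) * (inner ℝ v x - inner ℝ v μ₀)

theorem measurable_stdObs (n : ℕ → ℕ) (μ₀ v : Vec d) (j : ℕ) : Measurable (stdObs n μ₀ v j) := by
  unfold stdObs; fun_prop

theorem hasLaw_stdObs (hS₀ : S₀.PosSemidef)
    (hlaw : ∀ j, HasLaw (L j) (multivariateGaussian μ₀ (((n j : ℝ) + 1 / 2)⁻¹ • S₀)) P)
    (v : Vec d) (j : ℕ) :
    HasLaw (fun ω => stdObs n μ₀ v j (L j ω)) (gaussianReal 0 (quad S₀ v).toNNReal) P := by
  have hw := prec_pos n j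
  have hS : ((prec n j)⁻¹ • S₀).PosSemidef := hS₀.smul (inv_nonneg.2 hw.le)
  have h1 : HasLaw (fun x : Vec d => inner ℝ v x)
      (gaussianReal (inner ℝ v μ₀) ((prec n j)⁻¹ * quad S₀ v).toNNReal)
      (multivariateGaussian μ₀ ((prec n j)⁻¹ • S₀)) := by
    refine ⟨by fun_prop, ?_⟩
    have := IsGaussian.map_eq_gaussianReal (μ := multivariateGaussian μ₀ ((prec n j)⁻¹ • S₀))
      (innerSL ℝ v)
    rw [(innerSL ℝ v).integral_comp_id_comm IsGaussian.integrable_id,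
      integral_id_multivariateGaussian] at this
    have hv : Var[innerSL ℝ v; multivariateGaussian μ₀ ((prec n j)⁻¹ • S₀)] =
        (prec n j)⁻¹ * quad S₀ v := by
      rw [← quad_smul, quad, ← covarianceBilin_multivariateGaussian (μ := μ₀) hS,
        covarianceBilin_self IsGaussian.memLp_two_id]
      rfl
    rw [hv] at this
    exact this
  have h2 : HasLaw (fun ω => stdObs n μ₀ v j (L j ω)) _ P := gaussianReal_const_mul (gaussianReal_sub_const (h1.fun_comp (hlaw j)) (inner ℝ v μ₀))
    (√(prec n j))
  convert h2 using 2
  · simp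
  · ext
    have hq := quad_nonneg hS₀ v
    rw [NNReal.coe_mul, Real.coe_toNNReal _ hq, Real.coe_toNNReal _ (by positivity)]
    simp only [NNReal.coe_mk]
    rw [Real.sq_sqrt hw.le, mul_inv_cancel_left₀ hw.ne']

theorem iIndepFun_stdObs (hindep : iIndepFun L P) (v : Vec d) :
    iIndepFun (fun j ω => stdObs n μ₀ v j (L j ω)) P :=
  hindep.comp (fun j => stdObs n μ₀ v j) fun j => measurable_stdObs n μ₀ v j

theorem memLp_stdObs (hS₀ : S₀.PosSemidef)
    (hlaw : ∀ j, HasLaw (L j) (multivariateGaussian μ₀ (((n j : ℝ) + 1 / 2)⁻¹ • S₀)) P)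
    (v : Vec d) (j : ℕ) : MemLp (fun ω => stdObs n μ₀ v j (L j ω)) 2 P := by
  have h := hasLaw_stdObs hS₀ hlaw v j
  have h2 : MemLp id 2 (gaussianReal 0 (quad S₀ v).toNNReal) := IsGaussian.memLp_two_id
  rw [← h.map_eq] at h2
  exact (memLp_map_measure_iff h2.1 h.aemeasurable).1 h2

theorem integral_stdObs (hS₀ : S₀.PosSemidef)
    (hlaw : ∀ j, HasLaw (L j) (multivariateGaussian μ₀ (((n j : ℝ) + 1 / 2)⁻¹ • S₀)) P)
    (v : Vec d) (j : ℕ) : ∫ ω, stdObs n μ₀ v j (L j ω) ∂P = 0 := by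
  rw [(hasLaw_stdObs hS₀ hlaw v j).integral_eq, integral_id_gaussianReal]

theorem variance_stdObs (hS₀ : S₀.PosSemidef)
    (hlaw : ∀ j, HasLaw (L j) (multivariateGaussian μ₀ (((n j : ℝ) + 1 / 2)⁻¹ • S₀)) P)
    (v : Vec d) (j : ℕ) : Var[fun ω => stdObs n μ₀ v j (L j ω); P] = quad S₀ v := by
  rw [(hasLaw_stdObs hS₀ hlaw v j).variance_eq, variance_id_gaussianReal,
    Real.coe_toNNReal _ (quad_nonneg hS₀ v)]

theorem integral_stdObs_sq (hS₀ : S₀.PosSemidef)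
    (hlaw : ∀ j, HasLaw (L j) (multivariateGaussian μ₀ (((n j : ℝ) + 1 / 2)⁻¹ • S₀)) P)
    (v : Vec d) (j : ℕ) : ∫ ω, stdObs n μ₀ v j (L j ω) ^ 2 ∂P = quad S₀ v := by
  rw [← variance_stdObs hS₀ hlaw v j, variance_of_integral_eq_zero
    (hasLaw_stdObs hS₀ hlaw v j).aemeasurable (integral_stdObs hS₀ hlaw v j)]

/-- Standardising by √w_j removes the batch size from the law, so the squares are i.i.d. and the
strong law applies. -/
theorem ae_tendsto_sum_stdObs_sq (hS₀ : S₀.PosSemidef) (hindep : iIndepFun L P)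
    (hlaw : ∀ j, HasLaw (L j) (multivariateGaussian μ₀ (((n j : ℝ) + 1 / 2)⁻¹ • S₀)) P)
    (v : Vec d) :
    ∀ᵐ ω ∂P, Tendsto (fun K : ℕ => (∑ j ∈ Finset.range K, stdObs n μ₀ v j (L j ω) ^ 2) / K) atTop
      (𝓝 (quad S₀ v)) := by
  rw [← integral_stdObs_sq hS₀ hlaw v 0]
  refine strong_law_ae_real (fun j ω => stdObs n μ₀ v j (L j ω) ^ 2)
    (memLp_stdObs hS₀ hlaw v 0).integrable_sq (fun i j hij => ?_) fun j => ?_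
  · exact ((iIndepFun_stdObs hindep v).indepFun hij).comp (φ := fun r => r ^ 2)
      (ψ := fun r => r ^ 2) (by fun_prop) (by fun_prop)
  · have hid : IdentDistrib (fun ω => stdObs n μ₀ v j (L j ω))
        (fun ω => stdObs n μ₀ v 0 (L 0 ω)) P P :=
      ⟨(hasLaw_stdObs hS₀ hlaw v j).aemeasurable, (hasLaw_stdObs hS₀ hlaw v 0).aemeasurable, by
        rw [(hasLaw_stdObs hS₀ hlaw v j).map_eq, (hasLaw_stdObs hS₀ hlaw v 0).map_eq]⟩
    exact hid.comp (u := fun r => r ^ 2) (by fun_prop)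

variable [IsProbabilityMeasure P]

/-- Chebyshev's inequality for the weighted sample mean. -/
theorem measure_wmean_le (hS₀ : S₀.PosSemidef) (hindep : iIndepFun L P)
    (hlaw : ∀ j, HasLaw (L j) (multivariateGaussian μ₀ (((n j : ℝ) + 1 / 2)⁻¹ • S₀)) P)
    (v : Vec d) {K : ℕ} (hK : 1 ≤ K) {c : ℝ} (hc : 0 < c) :
    P {ω | c ≤ |inner ℝ v (wmean n K (fun j => L j ω) - μ₀)|} ≤
      ENNReal.ofReal (quad S₀ v / totalPrec n K / c ^ 2) := by
  have hW := totalPrec_pos n hK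
  set Y : ℕ → Ω → ℝ := fun j ω => √(prec n j) / totalPrec n K * stdObs n μ₀ v j (L j ω) with hY
  have hYm : ∀ j, MemLp (Y j) 2 P := fun j => (memLp_stdObs hS₀ hlaw v j).const_mul _
  have e : ∀ ω, inner ℝ v (wmean n K (fun j => L j ω) - μ₀) =
      (∑ j ∈ Finset.range K, Y j) ω := fun ω => by
    have h1 : ∀ j, Y j ω =
        (totalPrec n K)⁻¹ * (prec n j * inner ℝ v (L j ω) - prec n j * inner ℝ v μ₀) := fun j => by
      have := Real.mul_self_sqrt (prec_pos n j).le
      simp only [hY, stdObs]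
      linear_combination (inner ℝ v (L j ω) - inner ℝ v μ₀) / totalPrec n K * this
    rw [Finset.sum_apply, Finset.sum_congr rfl fun j _ => h1 j, ← Finset.mul_sum,
      Finset.sum_sub_distrib, ← Finset.sum_mul, ← totalPrec, inner_sub_right, wmean,
      inner_smul_right, inner_sum, mul_sub, inv_mul_cancel_left₀ hW.ne']
    simp only [inner_smul_right]
  have hmean : ∫ ω, (∑ j ∈ Finset.range K, Y j) ω ∂P = 0 := by
    simp only [Finset.sum_apply]
    rw [integral_finsetSum _ fun j _ => (hYm j).integrable one_le_two]
    refine Finset.sum_eq_zero fun j _ => ?_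
    rw [hY, integral_const_mul, integral_stdObs hS₀ hlaw, mul_zero]
  have hvar : Var[∑ j ∈ Finset.range K, Y j; P] = quad S₀ v / totalPrec n K := by
    rw [IndepFun.variance_sum (fun j _ => hYm j)]
    · have h1 : ∀ j, Var[Y j; P] = prec n j * (quad S₀ v / totalPrec n K ^ 2) := fun j => by
        rw [hY, variance_const_mul, variance_stdObs hS₀ hlaw, div_pow,
          Real.sq_sqrt (prec_pos n j).le]
        ring
      rw [Finset.sum_congr rfl fun j _ => h1 j, ← Finset.sum_mul, ← totalPrec]
      field_simp
    · intro i _ j _ hij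
      exact ((iIndepFun_stdObs hindep v).indepFun hij).comp
        (φ := fun r => √(prec n i) / totalPrec n K * r)
        (ψ := fun r => √(prec n j) / totalPrec n K * r) (by fun_prop) (by fun_prop)
  have h := meas_ge_le_variance_div_sq (memLp_finsetSum' (Finset.range K) fun j _ => hYm j) hc
  rw [hmean, hvar] at h
  simp only [e]
  simpa using h

theorem tendsto_ofReal_div_natCast (s : ℝ) :
    Tendsto (fun K : ℕ => ENNReal.ofReal (s / K)) atTop (𝓝 0) := by
  simpa using ENNReal.tendsto_ofReal (tendsto_const_div_atTop_nhds_zero_nat s)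

theorem tendsto_measure_wmean (hS₀ : S₀.PosSemidef) (hindep : iIndepFun L P)
    (hlaw : ∀ j, HasLaw (L j) (multivariateGaussian μ₀ (((n j : ℝ) + 1 / 2)⁻¹ • S₀)) P)
    (v : Vec d) {δ : ℝ} (hδ : 0 < δ) :
    Tendsto (fun K : ℕ => P {ω | δ ≤ |inner ℝ v (wmean n K (fun j => L j ω) - μ₀)|}) atTop
      (𝓝 0) := by
  have hq := quad_nonneg hS₀ v
  refine tendsto_of_tendsto_of_tendsto_of_le_of_le' tendsto_const_nhds
    (tendsto_ofReal_div_natCast (2 * quad S₀ v / δ ^ 2)) (Eventually.of_forall fun _ => zero_le) ?_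
  filter_upwards [eventually_ge_atTop 1] with K hK
  have hK' : (0 : ℝ) < K := by exact_mod_cast hK
  refine (measure_wmean_le hS₀ hindep hlaw v hK hδ).trans (ENNReal.ofReal_le_ofReal ?_)
  calc quad S₀ v / totalPrec n K / δ ^ 2 ≤ quad S₀ v / ((K : ℝ) / 2) / δ ^ 2 := by
        gcongr; exact half_le_totalPrec n K
    _ = _ := by field_simp

/-- The variable √W ⟨v, m − μ₀⟩ has variance vᵀS₀v for every K, so dividing its square by K sends it
to 0, however fast W grows. -/
theorem tendsto_measure_wmean_sq (hS₀ : S₀.PosSemidef) (hindep : iIndepFun L P)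
    (hlaw : ∀ j, HasLaw (L j) (multivariateGaussian μ₀ (((n j : ℝ) + 1 / 2)⁻¹ • S₀)) P)
    (v : Vec d) {δ : ℝ} (hδ : 0 < δ) :
    Tendsto (fun K : ℕ => P {ω | δ ≤ totalPrec n K *
      inner ℝ v (wmean n K (fun j => L j ω) - μ₀) ^ 2 / K}) atTop (𝓝 0) := by
  have hq := quad_nonneg hS₀ v
  refine tendsto_of_tendsto_of_tendsto_of_le_of_le' tendsto_const_nhds
    (tendsto_ofReal_div_natCast (quad S₀ v / δ)) (Eventually.of_forall fun _ => zero_le) ?_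
  filter_upwards [eventually_ge_atTop 1] with K hK
  have hK' : (0 : ℝ) < K := by exact_mod_cast hK
  have hW := totalPrec_pos n hK
  have hc : 0 < √(δ * K / totalPrec n K) := Real.sqrt_pos.2 (by positivity)
  calc P {ω | δ ≤ totalPrec n K * inner ℝ v (wmean n K (fun j => L j ω) - μ₀) ^ 2 / K}
      ≤ P {ω | √(δ * K / totalPrec n K) ≤ |inner ℝ v (wmean n K (fun j => L j ω) - μ₀)|} := by
        refine measure_mono fun ω hω => ?_
        rw [Set.mem_ofPred_eq] at hω ⊢
        refine Real.sqrt_le_iff.2 ⟨abs_nonneg _, ?_⟩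
        rw [sq_abs, div_le_iff₀ hW]
        rw [le_div_iff₀ hK'] at hω
        linarith
    _ ≤ ENNReal.ofReal (quad S₀ v / totalPrec n K / √(δ * K / totalPrec n K) ^ 2) :=
        measure_wmean_le hS₀ hindep hlaw v hK hc
    _ = ENNReal.ofReal (quad S₀ v / δ / K) := by
        rw [Real.sq_sqrt (by positivity)]
        congr 1
        field_simp

theorem quad_sum {ι : Type*} (s : Finset ι) (S : ι → Mat d) (v : Vec d) :
    quad (∑ i ∈ s, S i) v = ∑ i ∈ s, quad (S i) v := by
  simp [quad, sum_mulVec, dotProduct_sum]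

/-- Recentring at μ₀ exposes the i.i.d. sum; after division by K, the prior term and the correction
for the mean are negligible. -/
theorem quad_scatter (Ψ : Mat d) {K : ℕ} (hK : 1 ≤ K) (x : ℕ → Vec d) (v : Vec d) :
    quad (scatter Ψ n K x) v = quad Ψ v + ∑ j ∈ Finset.range K, stdObs n μ₀ v j (x j) ^ 2 -
      totalPrec n K * inner ℝ v (wmean n K x - μ₀) ^ 2 := by
  have h := congrArg (fun S => quad S v) (scaleMat_eq Ψ n hK x μ₀)
  simp only [quad_add, quad_outer, inner_smul_right, mul_pow,
    Real.sq_sqrt (totalPrec_pos n hK).le] at h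
  have h1 : quad (scaleMat Ψ n K x μ₀) v =
      quad Ψ v + ∑ j ∈ Finset.range K, stdObs n μ₀ v j (x j) ^ 2 := by
    rw [scaleMat, quad_add, quad_sum]
    congr 1
    refine Finset.sum_congr rfl fun j _ => ?_
    rw [quad_smul, quad_outer, stdObs, mul_pow, Real.sq_sqrt (prec_pos n j).le, inner_sub_right]
  rw [h1] at h
  rw [h, scatter, ← neg_sub μ₀, inner_neg_right, neg_sq]
  ring

theorem tendsto_measure_scatter (hS₀ : S₀.PosSemidef) (hindep : iIndepFun L P)
    (hlaw : ∀ j, HasLaw (L j) (multivariateGaussian μ₀ (((n j : ℝ) + 1 / 2)⁻¹ • S₀)) P)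
    (Ψ : Mat d) (v : Vec d) {δ : ℝ} (hδ : 0 < δ) :
    Tendsto (fun K : ℕ => P {ω | δ ≤ |quad (scatter Ψ n K (fun j => L j ω)) v / K - quad S₀ v|})
      atTop (𝓝 0) := by
  have h1 : TendstoInMeasure P
      (fun (K : ℕ) ω => (∑ j ∈ Finset.range K, stdObs n μ₀ v j (L j ω) ^ 2) / K) atTop
      (fun _ => quad S₀ v) := by
    refine tendstoInMeasure_of_tendsto_ae (fun K => ?_)
      (ae_tendsto_sum_stdObs_sq hS₀ hindep hlaw v)
    refine AEMeasurable.aestronglyMeasurable (AEMeasurable.div_const ?_ _)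
    exact Finset.aemeasurable_fun_sum _ fun j _ =>
      (hasLaw_stdObs hS₀ hlaw v j).aemeasurable.pow_const 2
  rw [tendstoInMeasure_iff_norm] at h1
  have h2 := (h1 (δ / 3) (by positivity)).add
    (tendsto_measure_wmean_sq hS₀ hindep hlaw v (δ := δ / 3) (by positivity))
  rw [add_zero] at h2
  refine tendsto_of_tendsto_of_tendsto_of_le_of_le' tendsto_const_nhds h2
    (Eventually.of_forall fun _ => zero_le) ?_
  have h3 := ((tendsto_const_div_atTop_nhds_zero_nat (quad Ψ v)).abs).eventually_lt_const
    (u := δ / 3) (by simpa using by positivity)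
  filter_upwards [eventually_ge_atTop 1, h3] with K hK h3
  refine (measure_mono fun ω hω => ?_).trans (measure_union_le _ _)
  by_contra hcon
  simp only [Set.mem_union, Set.mem_ofPred_eq, not_or, not_le, Real.norm_eq_abs] at hω hcon
  have hT : 0 ≤ totalPrec n K * inner ℝ v (wmean n K (fun j => L j ω) - μ₀) ^ 2 / K := by
    have := totalPrec_pos n hK
    positivity
  rw [quad_scatter (μ₀ := μ₀) Ψ hK, sub_div, add_div] at hω
  obtain ⟨h4, h5⟩ := hcon
  rw [abs_lt] at h3 h4
  refine absurd hω (not_le.2 (abs_lt.2 ⟨?_, ?_⟩)) <;> linarith [h3.1, h3.2, h4.1, h4.2]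

end Data

/-! ### Transfer from deterministic limits to convergence in probability. -/

/-- A quantity which tends to zero whenever finitely many statistics do tends to zero in
probability if these statistics do. -/
theorem tendsto_measure_of_tendsto {Ω J : Type*} [Fintype J] [MeasurableSpace Ω] {P : Measure Ω}
    {Y : J → ℕ → Ω → ℝ}
    (hY : ∀ j, ∀ δ : ℝ, 0 < δ → Tendsto (fun K => P {ω | δ ≤ |Y j K ω|}) atTop (𝓝 0))
    {B : ℕ → Ω → ℝ}
    (hB : Tendsto (fun p : ℕ × Ω => B p.1 p.2)
      (comap (fun p : ℕ × Ω => (p.1, fun j => Y j p.1 p.2)) (atTop ×ˢ 𝓝 (0 : J → ℝ))) (𝓝 0))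
    {ε : ℝ} (hε : 0 < ε) : Tendsto (fun K => P {ω | ε < B K ω}) atTop (𝓝 0) := by
  -- The hypothesis yields a fixed δ such that, for large K, B ≥ ε forces some |Y_j| ≥ δ. A union
  -- bound finishes; only set inclusions are used, so B need not be measurable.
  have h1 := hB.eventually_lt_const hε
  rw [eventually_comap, eventually_iff] at h1
  obtain ⟨U, hU, V, hV, hUV⟩ := mem_prod_iff.1 h1
  obtain ⟨δ, hδ, hball⟩ := Metric.mem_nhds_iff.1 hV
  have hsum : Tendsto (fun K => ∑ j, P {ω | δ ≤ |Y j K ω|}) atTop (𝓝 0) := by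
    simpa using tendsto_finsetSum Finset.univ fun j _ => hY j δ hδ
  refine tendsto_of_tendsto_of_tendsto_of_le_of_le' tendsto_const_nhds hsum
    (Eventually.of_forall fun _ => zero_le) ?_
  filter_upwards [hU] with K hK
  refine (measure_mono fun ω hω => ?_).trans (measure_iUnion_fintype_le P _)
  by_contra hcon
  simp only [Set.mem_iUnion, Set.mem_ofPred_eq, not_exists, not_le] at hcon hω
  have hin : (fun j => Y j K ω) ∈ V := hball (by
    rw [mem_ball_zero_iff, pi_norm_lt_iff hδ]
    exact hcon)
  have hmem : (K, fun j => Y j K ω) ∈ U ×ˢ V := ⟨hK, hin⟩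
  have := hUV hmem (K, ω) rfl
  exact lt_asymm hω this

namespace Model

variable {d : ℕ} (M : Model d) {μ₀ : Vec d} {S₀ : Mat d} {Ω : Type*} [MeasurableSpace Ω]
  {P : Measure Ω} {L : ℕ → Ω → Vec d}

theorem tendsto_measure_of_tendsto_posterior [IsProbabilityMeasure P] (hS₀ : S₀.PosSemidef) (hindep : iIndepFun L P)
    (hlaw : ∀ j, HasLaw (L j) (multivariateGaussian μ₀ (((M.n j : ℝ) + 1 / 2)⁻¹ • S₀)) P)
    {D : Measure (Param d) → ℝ}
    (hD : ∀ {l : Filter (ℕ × Ω)}, Tendsto Prod.fst l atTop →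
      Tendsto (fun a : ℕ × Ω => M.center a.1 (fun j => L j a.2)) l (𝓝 μ₀) →
      (∀ i j, Tendsto (fun a : ℕ × Ω => quad (M.scat a.1 (fun j => L j a.2)) (testVec i j) / a.1) l
        (𝓝 (quad S₀ (testVec i j)))) →
      Tendsto (fun a : ℕ × Ω => D (M.post a.1 (fun j => L j a.2))) l (𝓝 0))
    {ε : ℝ} (hε : 0 < ε) :
    Tendsto (fun K => ∫⁻ ω, M.post K (fun j => L j ω)
      {_θ | ε < D (M.post K (fun j => L j ω))} ∂P) atTop (𝓝 0) := by
  set Y : (Fin d × Fin d) ⊕ Fin d → ℕ → Ω → ℝ := Sum.elim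
    (fun p K ω => quad (M.scat K (fun j => L j ω)) (testVec p.1 p.2) / K -
      quad S₀ (testVec p.1 p.2))
    (fun i K ω => inner ℝ (EuclideanSpace.single i (1 : ℝ)) (M.center K (fun j => L j ω) - μ₀))
    with hYdef
  have hY : ∀ j, ∀ δ : ℝ, 0 < δ → Tendsto (fun K => P {ω | δ ≤ |Y j K ω|}) atTop (𝓝 0) := by
    rintro (p | i) δ hδ
    · exact tendsto_measure_scatter hS₀ hindep hlaw M.Ψ (testVec p.1 p.2) hδ
    · exact tendsto_measure_wmean hS₀ hindep hlaw _ hδ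
  have hconv := tendsto_measure_of_tendsto hY
    (B := fun K ω => D (M.post K (fun j => L j ω))) ?_ hε
  · refine tendsto_of_tendsto_of_tendsto_of_le_of_le' tendsto_const_nhds hconv
      (Eventually.of_forall fun _ => zero_le) ?_
    filter_upwards [M.eventually_regime tendsto_id] with K hK
    -- The event is independent of θ: it is everything or empty.
    have hle : ∀ ω, M.post K (fun j => L j ω) {_θ | ε < D (M.post K (fun j => L j ω))} ≤
        {ω | ε < D (M.post K (fun j => L j ω))}.indicator (fun _ => 1) ω := fun ω => by
      have : IsProbabilityMeasure (M.post K fun j => L j ω) :=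
        M.isProbabilityMeasure_post hK.1 hK.2 _
      by_cases h : ε < D (M.post K (fun j => L j ω))
      · rw [Set.indicator_of_mem (by exact h)]
        exact prob_le_one
      · simp [h]
    refine (lintegral_mono hle).trans ((lintegral_indicator_const_le _ _).trans ?_)
    rw [one_mul]
  -- Along this filter on pairs (K, ω), K tends to infinity and all statistics tend to 0, which are
  -- the hypotheses of `hD`.
  · set l := comap (fun p : ℕ × Ω => (p.1, fun j => Y j p.1 p.2))
      (atTop ×ˢ 𝓝 (0 : (Fin d × Fin d) ⊕ Fin d → ℝ))
    have ht : Tendsto (fun p : ℕ × Ω => (p.1, fun j => Y j p.1 p.2)) l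
      (atTop ×ˢ 𝓝 (0 : (Fin d × Fin d) ⊕ Fin d → ℝ)) := tendsto_comap
    have hj : ∀ j, Tendsto (fun p : ℕ × Ω => Y j p.1 p.2) l (𝓝 0) :=
      tendsto_pi_nhds.1 ht.snd
    have hfst : Tendsto (fun p : ℕ × Ω => p.1) l atTop := ht.fst
    refine hD hfst ?_ fun i j => ?_
    · rw [tendsto_iff_norm_sub_tendsto_zero]
      have hsq : Tendsto (fun p : ℕ × Ω => ∑ i, Y (Sum.inr i) p.1 p.2 ^ 2) l (𝓝 0) := by
        simpa using tendsto_finsetSum Finset.univ fun i _ => (hj (Sum.inr i)).pow 2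
      have := hsq.sqrt
      rw [Real.sqrt_zero] at this
      refine this.congr fun p => ?_
      rw [EuclideanSpace.norm_eq]
      simp [hYdef, EuclideanSpace.inner_single_left]
    · simpa [hYdef] using (hj (Sum.inl (i, j))).add_const (quad S₀ (testVec i j))

end Model

end HierGauss

theorem mainTheorem3 {d : ℕ} (hd : 1 ≤ d)
    -- hyperparameters of the priors
    (α : HierGauss.Vec d) (Ψ Ψp : HierGauss.Mat d) (hΨ : Ψ.PosDef) (hΨp : Ψp.PosDef)
    (ν νp : ℝ) (hν : (d : ℝ) - 1 < ν) (hνp : (d : ℝ) - 1 < νp)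
    -- batch sizes
    (n : ℕ → ℕ)
    -- true parameters
    (μ₀ : HierGauss.Vec d) (S₀ : HierGauss.Mat d) (hS₀ : S₀.PosSemidef)
    -- the data under the true parameters
    {Ω : Type*} [MeasurableSpace Ω] (P : Measure Ω) [IsProbabilityMeasure P]
    (L : ℕ → Ω → HierGauss.Vec d) (hindep : iIndepFun L P)
    (hlaw : ∀ j, HasLaw (L j) (multivariateGaussian μ₀ (((n j : ℝ) + 1 / 2)⁻¹ • S₀)) P) :
    -- the posterior means exist, whatever the data
    (∀ᶠ K in atTop, ∀ x : ℕ → HierGauss.Vec d,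
      IsProbabilityMeasure (HierGauss.posterior (HierGauss.prior α Ψ ν Ψp νp) n K x) ∧
      Integrable (fun θ : HierGauss.Param d => θ.1)
        (HierGauss.posterior (HierGauss.prior α Ψ ν Ψp νp) n K x) ∧
      ∀ i j, Integrable (fun θ : HierGauss.Param d => θ.2.1 i j)
        (HierGauss.posterior (HierGauss.prior α Ψ ν Ψp νp) n K x)) ∧
    -- consistency of the posterior mean of `μ`
    (∀ ε : ℝ, 0 < ε →
      Tendsto (fun K : ℕ => ∫⁻ ω,
        HierGauss.posterior (HierGauss.prior α Ψ ν Ψp νp) n K (fun j => L j ω)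
          {_θ : HierGauss.Param d | ε < ‖HierGauss.meanMu
            (HierGauss.posterior (HierGauss.prior α Ψ ν Ψp νp) n K (fun j => L j ω)) - μ₀‖} ∂P)
        atTop (𝓝 0)) ∧
    -- consistency of the posterior mean of `Σ`
    (∀ ε : ℝ, 0 < ε →
      Tendsto (fun K : ℕ => ∫⁻ ω,
        HierGauss.posterior (HierGauss.prior α Ψ ν Ψp νp) n K (fun j => L j ω)
          {_θ : HierGauss.Param d | ε < HierGauss.matNorm (HierGauss.meanSigma
            (HierGauss.posterior (HierGauss.prior α Ψ ν Ψp νp) n K (fun j => L j ω)) - S₀)} ∂P)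
        atTop (𝓝 0)) := by
  set M : HierGauss.Model d := ⟨hd, α, Ψ, Ψp, ν, νp, n, hΨ, hΨp, hν, hνp⟩
  refine ⟨?_, fun ε hε => ?_, fun ε hε => ?_⟩
  · filter_upwards [M.eventually_regime tendsto_id] with K hK x
    exact ⟨M.isProbabilityMeasure_post hK.1 hK.2 x, (M.integrable_fst hK.1 hK.2 x).2.1,
      M.integrable_entry hK.1 hK.2 x⟩
  · refine M.tendsto_measure_of_tendsto_posterior hS₀ hindep hlaw
      (D := fun Q => ‖HierGauss.meanMu Q - μ₀‖) (fun hk hμ hS => ?_) hε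
    exact tendsto_iff_norm_sub_tendsto_zero.1 (M.tendsto_meanMu hk hμ hS)
  · refine M.tendsto_measure_of_tendsto_posterior hS₀ hindep hlaw
      (D := fun Q => HierGauss.matNorm (HierGauss.meanSigma Q - S₀)) (fun hk hμ hS => ?_) hε
    -- Quadratic forms determine only the symmetric part of a matrix.
    have hsymm : S₀.IsSymm := by
      simpa [Matrix.IsHermitian, Matrix.IsSymm] using hS₀.isHermitian
    have h := M.tendsto_meanSigma hsymm hk hμ hS
    have hsq := tendsto_finsetSum Finset.univ fun i _ =>
      tendsto_finsetSum Finset.univ fun j _ => ((h i j).sub_const (S₀ i j)).pow 2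
    simpa [HierGauss.matNorm] using hsq.sqrt
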